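/- A lattice is a finitely generated free abelian group $N$; write $N_{\mathbb R}=N\otimes_{\mathbb Z}\mathbb R$ and $N^\vee=\operatorname{Hom}(N,\mathbb Z)$. A toric variety is given by a pair $(F,N)$, where $F$ is a fan in $N_{\mathbb R}$ (a finite collection of strongly convex cones, each generated by finitely many lattice vectors, closed under taking faces, any two of which intersect in a common face). Its geometric realization $\mathbb A(F,N)$ is the complex scheme glued from the charts $\operatorname{Spec}\mathbb C[\sigma^\vee\cap N^\vee]$, $\sigma\in F$, along the common faces. A toric morphism $p:(F,N)\to(G,Q)$ is a homomorphism $p:N\to Q$ such that $p_{\mathbb R}$ maps each cone of $F$ into some cone of $G$; it induces a morphism of schemes $\mathbb A(F,N)\to\mathbb A(G,Q)$. It satisfies the weak semistability conditions if 1. for every $\sigma\in F$ the image $p_{\mathbb R}(\sigma)$ is a cone of $G$, and 2. whenever $\sigma\in F$, $\kappa\in G$ and $p_{\mathbb R}(\sigma)=\kappa$, one has $p(N\cap\sigma)=Q\cap\kappa$. We call $p$ weakly semistable if it satisfies (1) and (2) and $p:N\to Q$ is surjective. For toric morphisms $p:(F,N)\to(G,Q)$ and $q:(G',Q')\to(G,Q)$,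 the toric fiber product $F\times_G G'$ is the fan of all cones $$\sigma\times_\kappa\lambda=\{z\in(N\times_Q Q')_{\mathbb R}:\ \mathrm{pr}_1(z)\in\sigma,\ \mathrm{pr}_2(z)\in\lambda\},$$ where $\sigma\in F$, $\lambda\in G'$, $\kappa\in G$, $p_{\mathbb R}(\sigma)\subseteq\kappa$ and $q_{\mathbb R}(\lambda)\subseteq\kappa$, in the lattice $N\times_Q Q'$. **Lemma.** Let $p:(F,N)\to(G,Q)$ be weakly semistable and let $q:(G',Q')\to(G,Q)$ be any toric morphism. Then the square of geometric realizations $$\begin{array}{ccc}\mathbb A(F\times_G G',\,N\times_Q Q')&\longrightarrow&\mathbb A(F,N)\\ \downarrow&&\downarrow\\ \mathbb A(G',Q')&\longrightarrow&\mathbb A(G,Q)\end{array}$$ induced by the two projections, $p$ and $q$ is cartesian in the category of schemes. Moreover, the projection $(F\times_G G',\,N\times_Q Q')\to(G',Q')$ is again weakly semistable. -/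

import Mathlib

open CategoryTheory CategoryTheory.Limits AlgebraicGeometry
open scoped TensorProduct

universe u

namespace Toric

/-- The real vector space `N_ℝ` of a lattice `N`. -/
abbrev RealSpan (N : Type u) [AddCommGroup N] : Type u := TensorProduct ℤ ℝ N

noncomputable section

attribute [local instance] CategoryTheory.CategoryStruct.toQuiver

section Cones

variable {N : Type u} [AddCommGroup N]

/-- The real-valued linear functional on `N_ℝ` extending an element of the dual lattice. -/
abbrev evalR (m : Module.Dual ℤ N) : Module.Dual ℝ (RealSpan N) := Module.Dual.baseChange ℝ m

@[simp] theorem evalR_tmul (m : Module.Dual ℤ N) (r : ℝ) (n : N) :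
    evalR m (r ⊗ₜ[ℤ] n) = (m n : ℝ) * r := by
  simp [evalR]

theorem evalR_smul (a : ℤ) (m : Module.Dual ℤ N) (x : RealSpan N) :
    evalR (a • m) x = (a : ℝ) * evalR m x := by
  simp [evalR]

/-- `σ` is generated by finitely many lattice vectors. -/
def IsRationalPolyhedral (σ : PointedCone ℝ (RealSpan N)) : Prop :=
  ∃ s : Finset N, σ = PointedCone.hull ℝ ((fun n : N => (1 : ℝ) ⊗ₜ[ℤ] n) '' (s : Set N))

theorem mem_hull_insert {E : Type*} [AddCommGroup E] [Module ℝ E] (v : E) (s : Set E) (x : E) :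
    x ∈ PointedCone.hull ℝ (insert v s) ↔
      ∃ a : ℝ, 0 ≤ a ∧ x - a • v ∈ PointedCone.hull ℝ s := by
  rw [PointedCone.hull, Submodule.mem_span_insert]
  constructor
  · rintro ⟨a, z, hz, rfl⟩
    exact ⟨a, a.2, by simpa using! hz⟩
  · rintro ⟨a, ha, h⟩
    exact ⟨⟨a, ha⟩, _, h, by simp⟩

/-- One step of the elimination of a variable. -/
theorem elim_step {ι : Type*} (t : Finset ι) (x v : ι → ℝ) :
    (∃ a : ℝ, 0 ≤ a ∧ ∀ i ∈ t, 0 ≤ x i - a * v i) ↔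
      (∀ i ∈ t, 0 ≤ v i → 0 ≤ x i) ∧
      (∀ i ∈ t, ∀ j ∈ t, 0 ≤ v i → v j ≤ 0 → 0 ≤ v i * x j - v j * x i) := by
  classical
  constructor
  · rintro ⟨a, ha, h⟩
    refine ⟨fun i hi hv => ?_, fun i hi j hj hvi hvj => ?_⟩
    · have := h i hi
      have := mul_nonneg ha hv
      linarith
    · nlinarith [mul_nonneg hvi (h j hj), mul_nonneg (neg_nonneg.2 hvj) (h i hi)]
  · rintro ⟨h1, h2⟩
    let A : Finset ℝ := insert 0 ((t.filter fun j => v j < 0).image fun j => x j / v j)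
    have hA : A.Nonempty := ⟨0, by simp [A]⟩
    refine ⟨A.max' hA, A.le_max' _ (by simp [A]), fun i hi => ?_⟩
    rcases lt_trichotomy (v i) 0 with hv | hv | hv
    · have : x i / v i ≤ A.max' hA := A.le_max' _ (by
        simp only [A, Finset.mem_insert, Finset.mem_image, Finset.mem_filter]
        exact Or.inr ⟨i, ⟨hi, hv⟩, rfl⟩)
      have := (div_le_iff_of_neg hv).1 this
      linarith
    · simpa [hv] using h1 i hi hv.ge
    · have hm := A.max'_mem hA
      simp only [A, Finset.mem_insert, Finset.mem_image, Finset.mem_filter] at hm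
      rcases hm with hm | ⟨j, ⟨hj, hvj⟩, hm⟩
      · simp only [A, hm, zero_mul, sub_zero]
        exact h1 i hi hv.le
      · simp only [A, ← hm]
        have := h2 i hi j hj hv.le hvj.le
        have h3 : x j / v j * v i ≤ x i := by
          rw [div_mul_eq_mul_div, div_le_iff_of_neg hvj]
          linarith
        linarith

theorem exists_functionals_zero [Module.Free ℤ N] [Module.Finite ℤ N] :
    ∃ t : Finset (Module.Dual ℤ N), ∀ x : RealSpan N, x = 0 ↔ ∀ m ∈ t, 0 ≤ evalR m x := by
  classical
  let b := Module.Free.chooseBasis ℤ N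
  let B := b.baseChange ℝ
  refine ⟨Finset.univ.image b.coord ∪ Finset.univ.image fun i => -b.coord i, fun x => ?_⟩
  have key : ∀ i, evalR (b.coord i) x = B.repr x i := by
    intro i
    have : evalR (b.coord i) = B.coord i := by
      refine B.ext fun j => ?_
      simp [B, Finsupp.single_apply]
    rw [this]; rfl
  constructor
  · rintro rfl; simp
  · intro h
    refine B.ext_elem fun i => ?_
    have h1 := h (b.coord i) (by simp)
    have h2 := h (-b.coord i) (by simp)
    rw [evalR, map_neg, LinearMap.neg_apply] at h2
    rw [key] at h1
    have h3 := key i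
    simp only [evalR] at h3
    rw [h3] at h2
    simp only [map_zero, Finsupp.coe_zero, Pi.zero_apply]
    linarith

/-- A cone generated by finitely many lattice vectors is cut out by finitely many integral
linear inequalities. -/
theorem exists_functionals [Module.Free ℤ N] [Module.Finite ℤ N] (s : Finset N) :
    ∃ t : Finset (Module.Dual ℤ N), ∀ x : RealSpan N,
      x ∈ PointedCone.hull ℝ ((fun n : N => (1 : ℝ) ⊗ₜ[ℤ] n) '' (s : Set N)) ↔
        ∀ m ∈ t, 0 ≤ evalR m x := by
  classical
  induction s using Finset.induction_on with
  | empty =>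
    obtain ⟨t, ht⟩ := exists_functionals_zero (N := N)
    exact ⟨t, fun x => by rw [← ht]; simp⟩
  | insert n s hn ih =>
    obtain ⟨t, ht⟩ := ih
    refine ⟨(t.filter fun m => 0 ≤ m n) ∪
      ((t ×ˢ t).filter fun p => 0 ≤ p.1 n ∧ p.2 n ≤ 0).image
        fun p => p.1 n • p.2 - p.2 n • p.1, fun x => ?_⟩
    rw [Finset.coe_insert, Set.image_insert_eq, mem_hull_insert]
    have e := elim_step t (fun m => evalR m x) (fun m => (m n : ℝ))
    simp only [ht]
    have e1 : ∀ a : ℝ, ∀ m : Module.Dual ℤ N,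
        evalR m (x - a • (1 : ℝ) ⊗ₜ[ℤ] n) = evalR m x - a * (m n : ℝ) := by
      intro a m
      rw [map_sub, map_smul, evalR_tmul, smul_eq_mul, mul_one]
    simp only [e1, e]
    simp only [Finset.mem_union, Finset.mem_filter, Finset.mem_image, Finset.mem_product,
      Prod.exists]
    constructor
    · rintro ⟨h1, h2⟩ m (⟨hm, hn⟩ | ⟨a, b, ⟨⟨ha, hb⟩, ha', hb'⟩, rfl⟩)
      · exact h1 m hm (by exact_mod_cast hn)
      · have := h2 a ha b hb (by exact_mod_cast ha') (by exact_mod_cast hb')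
        rw [evalR, map_sub, LinearMap.sub_apply]
        rwa [← evalR, ← evalR, evalR_smul, evalR_smul]
    · intro h
      refine ⟨fun m hm hn => h m (Or.inl ⟨hm, by exact_mod_cast hn⟩), fun a ha b hb ha' hb' => ?_⟩
      have := h _ (Or.inr ⟨a, b, ⟨⟨ha, hb⟩, by exact_mod_cast ha', by exact_mod_cast hb'⟩, rfl⟩)
      rw [evalR, map_sub, LinearMap.sub_apply] at this
      rwa [← evalR, ← evalR, evalR_smul, evalR_smul] at this

/-- A cone cut out by finitely many integral linear inequalities is generated by finitely many
lattice vectors. -/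
theorem isRationalPolyhedral_of_functionals [Module.Free ℤ N] [Module.Finite ℤ N]
    (t : Finset (Module.Dual ℤ N)) (σ : PointedCone ℝ (RealSpan N))
    (h : ∀ x, x ∈ σ ↔ ∀ m ∈ t, 0 ≤ evalR m x) : IsRationalPolyhedral σ := by
  classical
  obtain ⟨t', ht'⟩ := exists_functionals t
  let e := Module.evalEquiv ℤ N
  let s : Finset N := t'.image e.symm
  have hs : ∀ φ : Module.Dual ℤ (Module.Dual ℤ N), ∀ m, m (e.symm φ) = φ m := fun φ m => by
    conv_rhs => rw [← e.apply_symm_apply φ]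
    rfl
  refine ⟨s, le_antisymm (fun x hx => ?_) (Submodule.span_le.2 ?_)⟩
  · obtain ⟨t'', ht''⟩ := exists_functionals s
    rw [ht'']
    intro l hl
    have h1 : (1 : ℝ) ⊗ₜ[ℤ] l ∈
        PointedCone.hull ℝ ((fun n => (1 : ℝ) ⊗ₜ[ℤ] n) '' (t : Set (Module.Dual ℤ N))) := by
      rw [ht']
      intro φ hφ
      have h2 : (1 : ℝ) ⊗ₜ[ℤ] (e.symm φ) ∈
          PointedCone.hull ℝ ((fun n => (1 : ℝ) ⊗ₜ[ℤ] n) '' (s : Set N)) :=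
        Submodule.subset_span ⟨_, by simpa [s] using hφ, rfl⟩
      rw [ht''] at h2
      have := h2 l hl
      rw [evalR_tmul, hs] at this
      rwa [evalR_tmul]
    let B : RealSpan (Module.Dual ℤ N) →ₗ[ℝ] Module.Dual ℝ (RealSpan N) :=
      LinearMap.liftBaseChange ℝ (Module.Dual.baseChange ℝ : Module.Dual ℤ N →ₗ[ℤ] _)
    have hB : ∀ m, B (1 ⊗ₜ m) = evalR m := fun m => by simp [B, evalR]
    have h3 : ∀ y ∈ PointedCone.hull ℝ ((fun n => (1 : ℝ) ⊗ₜ[ℤ] n) '' (t : Set (Module.Dual ℤ N))),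
        0 ≤ B y x := by
      intro y hy
      induction hy using Submodule.span_induction with
      | mem y hy =>
        obtain ⟨m, hm, rfl⟩ := hy
        simp only [hB]
        exact (h x).1 hx m hm
      | zero => simp
      | add y z _ _ hy hz => rw [map_add, LinearMap.add_apply]; exact add_nonneg hy hz
      | smul a y _ hy =>
        have : B (a • y) = (a : ℝ) • B y := map_smul B (a : ℝ) y
        rw [this, LinearMap.smul_apply]
        exact mul_nonneg a.2 hy
    rw [← hB]
    exact h3 _ h1
  · rintro _ ⟨n, hn, rfl⟩
    rw [SetLike.mem_coe, h]
    intro m hm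
    have h2 : (1 : ℝ) ⊗ₜ[ℤ] m ∈
        PointedCone.hull ℝ ((fun n => (1 : ℝ) ⊗ₜ[ℤ] n) '' (t : Set (Module.Dual ℤ N))) :=
      Submodule.subset_span ⟨m, hm, rfl⟩
    rw [ht'] at h2
    obtain ⟨φ, hφ, rfl⟩ := Finset.mem_image.1 hn
    have := h2 φ hφ
    rw [evalR_tmul] at this
    rwa [evalR_tmul, hs]

/-- A face of a rational polyhedral cone is cut out by a lattice functional which is nonnegative
on the cone. -/
theorem exists_functional_of_isFaceOf [Module.Free ℤ N] [Module.Finite ℤ N]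
    {σ τ : PointedCone ℝ (RealSpan N)} (hσ : IsRationalPolyhedral σ) (h : τ.IsFaceOf σ) :
    ∃ m : Module.Dual ℤ N, (∀ x ∈ σ, 0 ≤ evalR m x) ∧ ∀ x ∈ σ, x ∈ τ ↔ evalR m x = 0 := by
  classical
  obtain ⟨s, rfl⟩ := hσ
  obtain ⟨t, ht⟩ := exists_functionals s
  set σ := PointedCone.hull ℝ ((fun n : N => (1 : ℝ) ⊗ₜ[ℤ] n) '' (s : Set N))
  -- the inequalities that are equalities on the face
  let I := t.filter fun m => ∀ x ∈ τ, evalR m x = 0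
  have hsum : ∀ x, evalR (∑ m ∈ I, m) x = ∑ m ∈ I, evalR m x := fun x => by
    simp [evalR, map_sum]
  have hnn : ∀ x ∈ σ, ∀ m ∈ I, 0 ≤ evalR m x :=
    fun x hx m hm => (ht x).1 hx m (Finset.mem_filter.1 hm).1
  refine ⟨∑ m ∈ I, m, fun x hx => ?_, fun x hx => ⟨fun hx' => ?_, fun h0 => ?_⟩⟩
  · rw [hsum]
    exact Finset.sum_nonneg (hnn x hx)
  · rw [hsum]
    exact Finset.sum_eq_zero fun m hm => (Finset.mem_filter.1 hm).2 x hx'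
  · rw [hsum, Finset.sum_eq_zero_iff_of_nonneg (hnn x hx)] at h0
    have h1 : ∀ m ∈ t \ I, ∃ z ∈ τ, 0 < evalR m z := by
      intro m hm
      simp only [I, Finset.mem_sdiff, Finset.mem_filter, not_and, not_forall] at hm
      obtain ⟨z, hz, hz'⟩ := hm.2 hm.1
      exact ⟨z, hz, lt_of_le_of_ne ((ht z).1 (h.le hz) m hm.1) (Ne.symm hz')⟩
    choose! z hz hz' using h1
    let w := ∑ m ∈ t \ I, z m
    have hw : w ∈ τ := Submodule.sum_mem _ hz
    have hw' : ∀ m ∈ t \ I, 0 < evalR m w := by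
      intro m hm
      rw [map_sum]
      refine lt_of_lt_of_le (hz' m hm) (Finset.single_le_sum (f := fun k => evalR m (z k))
        (fun k hk => (ht _).1 (h.le (hz k hk)) m (Finset.mem_sdiff.1 hm).1) hm)
    -- a large multiple of `w` dominates `x`
    have h2 : ∃ a : ℝ, 0 < a ∧ ∀ m ∈ t \ I, evalR m x ≤ a * evalR m w := by
      let A : Finset ℝ := insert 1 ((t \ I).image fun m => evalR m x / evalR m w)
      have hA : A.Nonempty := ⟨1, by simp [A]⟩
      refine ⟨A.max' hA, lt_of_lt_of_le one_pos (A.le_max' _ (by simp [A])), fun m hm => ?_⟩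
      rw [← div_le_iff₀ (hw' m hm)]
      exact A.le_max' _ (Finset.mem_insert_of_mem (Finset.mem_image_of_mem _ hm))
    obtain ⟨a, ha, hax⟩ := h2
    have h3 : a • w - x ∈ σ := by
      rw [ht]
      intro m hm
      rw [map_sub, map_smul, smul_eq_mul]
      by_cases hmI : m ∈ I
      · rw [(Finset.mem_filter.1 hmI).2 w hw, h0 m hmI]; simp
      · linarith [hax m (Finset.mem_sdiff.2 ⟨hm, hmI⟩)]
    refine h.mem_of_add_mem_left hx h3 ?_
    rw [add_sub_cancel]
    exact PointedCone.smul_mem _ ha.le hw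


end Cones

section Charts

variable {N Q L : Type u} [AddCommGroup N] [AddCommGroup Q] [AddCommGroup L]

/-- The linear map `p_ℝ : N_ℝ → Q_ℝ` induced by a homomorphism of lattices. -/
abbrev realMap (p : N →ₗ[ℤ] Q) : RealSpan N →ₗ[ℝ] RealSpan Q := p.baseChange ℝ

theorem evalR_comp (m : Module.Dual ℤ Q) (p : N →ₗ[ℤ] Q) (x : RealSpan N) :
    evalR (m ∘ₗ p) x = evalR m (realMap p x) := by
  have : evalR (m ∘ₗ p) = evalR m ∘ₗ realMap p := by ext n; simp
  rw [this]; rfl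

/-- The monoid `σ^∨ ∩ N^∨` of lattice functionals which are nonnegative on the cone `σ`. -/
def dualMonoid (σ : PointedCone ℝ (RealSpan N)) : AddSubmonoid (Module.Dual ℤ N) where
  carrier := {m | ∀ x ∈ σ, 0 ≤ evalR m x}
  zero_mem' := fun x _ => by simp [evalR]
  add_mem' := fun {a b} ha hb x hx => by
    rw [evalR, map_add]; exact add_nonneg (ha x hx) (hb x hx)

/-- The map of dual monoids induced by a lattice homomorphism which takes `σ` into `κ`. -/
def dualMonoidMap {σ : PointedCone ℝ (RealSpan N)} {κ : PointedCone ℝ (RealSpan Q)}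
    (p : N →ₗ[ℤ] Q) (h : ∀ x ∈ σ, realMap p x ∈ κ) : dualMonoid κ →+ dualMonoid σ where
  toFun m := ⟨m.1 ∘ₗ p, fun x hx => by rw [evalR_comp]; exact m.2 _ (h x hx)⟩
  map_zero' := rfl
  map_add' _ _ := rfl

/-- The affine toric variety `Spec ℂ[σ^∨ ∩ N^∨]`. -/
def chart (σ : PointedCone ℝ (RealSpan N)) : Scheme.{u} :=
  Spec (CommRingCat.of (AddMonoidAlgebra ℂ (dualMonoid σ)))

/-- The morphism of affine toric varieties induced by a lattice homomorphism which takes `σ`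
into `κ`. -/
def chartMap {σ : PointedCone ℝ (RealSpan N)} {κ : PointedCone ℝ (RealSpan Q)}
    (p : N →ₗ[ℤ] Q) (h : ∀ x ∈ σ, realMap p x ∈ κ) : chart σ ⟶ chart κ :=
  Spec.map (CommRingCat.ofHom (AddMonoidAlgebra.mapDomainRingHom ℂ (dualMonoidMap p h)))

theorem chartMap_comp {σ : PointedCone ℝ (RealSpan N)} {κ : PointedCone ℝ (RealSpan Q)}
    {ρ : PointedCone ℝ (RealSpan L)} {p : N →ₗ[ℤ] Q} (h : ∀ x ∈ σ, realMap p x ∈ κ)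
    {q : Q →ₗ[ℤ] L} (h' : ∀ x ∈ κ, realMap q x ∈ ρ) {r : N →ₗ[ℤ] L} (hr : q ∘ₗ p = r)
    (h'' : ∀ x ∈ σ, realMap r x ∈ ρ) : chartMap p h ≫ chartMap q h' = chartMap r h'' := by
  subst hr
  have : dualMonoidMap (q ∘ₗ p) h'' = (dualMonoidMap p h).comp (dualMonoidMap q h') := rfl
  unfold chartMap
  rw [this, AddMonoidAlgebra.mapDomainRingHom_comp, CommRingCat.ofHom_comp, Spec.map_comp]
  rfl

/-- The inclusion of the affine chart of a smaller cone. -/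
def chartIncl {σ τ : PointedCone ℝ (RealSpan N)} (h : τ ≤ σ) : chart τ ⟶ chart σ :=
  chartMap LinearMap.id fun x hx => by simpa using h hx

theorem chartIncl_refl (σ : PointedCone ℝ (RealSpan N)) : chartIncl (le_refl σ) = 𝟙 _ := by
  rw [chartIncl, chartMap]
  have : dualMonoidMap (σ := σ) (κ := σ) LinearMap.id (fun x hx => by simpa using hx) =
    AddMonoidHom.id _ := rfl
  rw [this, AddMonoidAlgebra.mapDomainRingHom_id]
  exact Spec.map_id _

theorem chartIncl_trans {σ τ ρ : PointedCone ℝ (RealSpan N)} (h : τ ≤ σ) (h' : ρ ≤ τ) :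
    chartIncl h' ≫ chartIncl h = chartIncl (h'.trans h) :=
  chartMap_comp _ _ (LinearMap.id_comp _) _

theorem chartIncl_chartMap {σ τ : PointedCone ℝ (RealSpan N)} {κ : PointedCone ℝ (RealSpan Q)}
    (h : τ ≤ σ) (p : N →ₗ[ℤ] Q) (h' : ∀ x ∈ σ, realMap p x ∈ κ) :
    chartIncl h ≫ chartMap p h' = chartMap p fun x hx => h' x (h hx) :=
  chartMap_comp _ _ (LinearMap.comp_id _) _

theorem chartMap_chartIncl {σ : PointedCone ℝ (RealSpan N)} {κ ρ : PointedCone ℝ (RealSpan Q)}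
    (p : N →ₗ[ℤ] Q) (h' : ∀ x ∈ σ, realMap p x ∈ ρ) (h : ρ ≤ κ) :
    chartMap p h' ≫ chartIncl h = chartMap p fun x hx => h (h' x hx) :=
  chartMap_comp _ _ (LinearMap.id_comp _) _

/-- If `m` is nonnegative on a rational polyhedral cone `σ`, then passing to `σ ∩ m^⊥` inverts
the character `m`. -/
theorem exists_add_smul_mem {σ τ : PointedCone ℝ (RealSpan N)} (hσ : IsRationalPolyhedral σ)
    {m : Module.Dual ℤ N} (hm : m ∈ dualMonoid σ) (hτ : ∀ x ∈ σ, x ∈ τ ↔ evalR m x = 0)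
    {w : Module.Dual ℤ N} (hw : w ∈ dualMonoid τ) : ∃ k : ℕ, w + k • m ∈ dualMonoid σ := by
  classical
  obtain ⟨s, rfl⟩ := hσ
  have hs : ∀ n ∈ s, (1 : ℝ) ⊗ₜ[ℤ] n ∈
      PointedCone.hull ℝ ((fun n : N => (1 : ℝ) ⊗ₜ[ℤ] n) '' (s : Set N)) :=
    fun n hn => Submodule.subset_span ⟨n, hn, rfl⟩
  have hms : ∀ n ∈ s, 0 ≤ m n := fun n hn => by
    have := hm _ (hs n hn)
    rw [evalR_tmul, mul_one] at this
    exact_mod_cast this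
  refine ⟨∑ n ∈ s, (w n).natAbs, fun x hx => ?_⟩
  set k := ∑ n ∈ s, (w n).natAbs
  induction hx using Submodule.span_induction with
  | mem y hy =>
    obtain ⟨n, hn, rfl⟩ := hy
    simp only [evalR_tmul, mul_one]
    norm_cast
    simp only [LinearMap.add_apply, LinearMap.smul_apply]
    rcases (hms n hn).eq_or_lt with h0 | h0
    · have h1 := hw _ ((hτ _ (hs n hn)).2 (by rw [evalR_tmul, ← h0]; simp))
      rw [evalR_tmul, mul_one] at h1
      rw [← h0, smul_zero, add_zero]
      exact_mod_cast h1
    · have h1 : (w n).natAbs ≤ k :=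
        Finset.single_le_sum (f := fun n => (w n).natAbs) (fun _ _ => Nat.zero_le _) hn
      have h2 : (k : ℤ) * 1 ≤ k * m n := mul_le_mul_of_nonneg_left h0 (by positivity)
      rw [nsmul_eq_mul]
      have h3 : ((w n).natAbs : ℤ) ≤ k := by exact_mod_cast h1
      have := neg_abs_le (w n)
      rw [Int.abs_eq_natAbs] at this
      push_cast at *
      linarith
  | zero => simp
  | add y z _ _ hy hz => rw [map_add]; exact add_nonneg hy hz
  | smul a y _ hy =>
    have : evalR (w + k • m) (a • y) = (a : ℝ) • evalR (w + k • m) y :=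
      map_smul (evalR (w + k • m)) (a : ℝ) y
    rw [this]
    exact mul_nonneg a.2 hy

theorem neg_mem_dualMonoid {σ τ : PointedCone ℝ (RealSpan N)} (h : τ ≤ σ)
    {m : Module.Dual ℤ N} (hτ : ∀ x ∈ σ, x ∈ τ ↔ evalR m x = 0) : -m ∈ dualMonoid τ := by
  intro x hx
  have := (hτ x (h hx)).1 hx
  rw [evalR, map_neg, LinearMap.neg_apply]
  rw [evalR] at this
  rw [this]; simp

/-- Passing to the face `σ ∩ m^⊥` localizes the coordinate ring at the character `m`. -/
theorem isLocalization_away {σ τ : PointedCone ℝ (RealSpan N)} (hσ : IsRationalPolyhedral σ)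
    (h : τ ≤ σ) {m : Module.Dual ℤ N} (hm : m ∈ dualMonoid σ)
    (hτ : ∀ x ∈ σ, x ∈ τ ↔ evalR m x = 0)
    (h' : ∀ x ∈ τ, realMap LinearMap.id x ∈ σ) :
    let := (AddMonoidAlgebra.mapDomainRingHom ℂ (dualMonoidMap (σ := τ) (κ := σ)
      LinearMap.id h')).toAlgebra
    IsLocalization.Away
      (AddMonoidAlgebra.single (⟨m, hm⟩ : dualMonoid σ) (1 : ℂ))
      (AddMonoidAlgebra ℂ (dualMonoid τ)) := by
  let := (AddMonoidAlgebra.mapDomainRingHom ℂ (dualMonoidMap (σ := τ) (κ := σ)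
      LinearMap.id h')).toAlgebra
  let j := dualMonoidMap (σ := τ) (κ := σ) LinearMap.id h'
  have hj : Function.Injective j := fun a b hab =>
    Subtype.ext (congrArg (fun c : dualMonoid τ => (c : Module.Dual ℤ N)) hab)
  have halg : ∀ f : AddMonoidAlgebra ℂ (dualMonoid σ),
    algebraMap _ (AddMonoidAlgebra ℂ (dualMonoid τ)) f = AddMonoidAlgebra.mapDomain j f :=
    fun f => rfl
  have hj' : ∀ a, (j a : Module.Dual ℤ N) = a := fun _ => rfl
  have hm' : IsUnit (algebraMap _ (AddMonoidAlgebra ℂ (dualMonoid τ))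
      (AddMonoidAlgebra.single (⟨m, hm⟩ : dualMonoid σ) (1 : ℂ))) := by
    refine IsUnit.of_mul_eq_one
      (AddMonoidAlgebra.single (⟨-m, neg_mem_dualMonoid h hτ⟩ : dualMonoid τ) (1 : ℂ)) ?_
    rw [halg, AddMonoidAlgebra.mapDomain_single, AddMonoidAlgebra.single_mul_single,
      AddMonoidAlgebra.one_def]
    congr 1
    · exact Subtype.ext (by simp [hj'])
    · simp
  refine IsLocalization.Away.mk _ hm' (fun f => ?_) fun a b hab => ?_
  · induction f using AddMonoidAlgebra.induction_linear with
    | zero => exact ⟨0, 0, by simp⟩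
    | add f g hf hg =>
      obtain ⟨k, a, ha⟩ := hf
      obtain ⟨l, b, hb⟩ := hg
      refine ⟨k + l, a * AddMonoidAlgebra.single (⟨m, hm⟩ : dualMonoid σ) (1 : ℂ) ^ l +
        b * AddMonoidAlgebra.single (⟨m, hm⟩ : dualMonoid σ) (1 : ℂ) ^ k, ?_⟩
      rw [map_add, map_mul, map_mul, ← ha, ← hb, map_pow, map_pow]
      ring
    | single w c =>
      obtain ⟨k, hk⟩ := exists_add_smul_mem hσ hm hτ w.2
      refine ⟨k, AddMonoidAlgebra.single (⟨_, hk⟩ : dualMonoid σ) c, ?_⟩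
      rw [halg, halg, AddMonoidAlgebra.mapDomain_single, AddMonoidAlgebra.mapDomain_single,
        AddMonoidAlgebra.single_pow, AddMonoidAlgebra.single_mul_single, one_pow, mul_one]
      exact congrArg (fun z => AddMonoidAlgebra.single z c) (Subtype.ext rfl)
  · exact ⟨0, by rw [AddMonoidAlgebra.mapDomain_injective hj hab]⟩

theorem isOpenImmersion_chartIncl {σ τ : PointedCone ℝ (RealSpan N)}
    (hσ : IsRationalPolyhedral σ) (h : τ ≤ σ) {m : Module.Dual ℤ N} (hm : m ∈ dualMonoid σ)
    (hτ : ∀ x ∈ σ, x ∈ τ ↔ evalR m x = 0) : IsOpenImmersion (chartIncl h) := by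
  have h' : ∀ x ∈ τ, realMap LinearMap.id x ∈ σ := fun x hx => by simpa using h hx
  let := (AddMonoidAlgebra.mapDomainRingHom ℂ (dualMonoidMap (σ := τ) (κ := σ)
      LinearMap.id h')).toAlgebra
  have := isLocalization_away hσ h hm hτ h'
  exact IsOpenImmersion.of_isLocalization
    (AddMonoidAlgebra.single (⟨m, hm⟩ : dualMonoid σ) (1 : ℂ))

theorem range_chartIncl {σ τ : PointedCone ℝ (RealSpan N)}
    (hσ : IsRationalPolyhedral σ) (h : τ ≤ σ) {m : Module.Dual ℤ N} (hm : m ∈ dualMonoid σ)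
    (hτ : ∀ x ∈ σ, x ∈ τ ↔ evalR m x = 0) : Set.range (chartIncl h) =
      (PrimeSpectrum.basicOpen (AddMonoidAlgebra.single (⟨m, hm⟩ : dualMonoid σ) (1 : ℂ)) :
        Set (PrimeSpectrum (AddMonoidAlgebra ℂ (dualMonoid σ)))) := by
  have h' : ∀ x ∈ τ, realMap LinearMap.id x ∈ σ := fun x hx => by simpa using h hx
  let := (AddMonoidAlgebra.mapDomainRingHom ℂ (dualMonoidMap (σ := τ) (κ := σ)
      LinearMap.id h')).toAlgebra
  have := isLocalization_away hσ h hm hτ h'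
  exact PrimeSpectrum.localization_away_comap_range _
    (AddMonoidAlgebra.single (⟨m, hm⟩ : dualMonoid σ) (1 : ℂ))

end Charts

section Fans

/-- A fan in the lattice `N`: a finite collection of strongly convex rational polyhedral cones in
`N_ℝ`, closed under taking faces, such that the intersection of any two of its cones is a face of
each. The pair `(F, N)` is the combinatorial datum of a toric variety. -/
structure Fan (N : Type u) [AddCommGroup N] where
  cones : Set (PointedCone ℝ (RealSpan N))
  finite_cones : cones.Finite
  isRationalPolyhedral : ∀ σ ∈ cones, IsRationalPolyhedral σ
  stronglyConvex : ∀ σ ∈ cones, ∀ x ∈ σ, -x ∈ σ → x = 0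
  face_mem : ∀ σ ∈ cones, ∀ τ : PointedCone ℝ (RealSpan N), τ.IsFaceOf σ → τ ∈ cones
  inf_isFaceOf : ∀ σ ∈ cones, ∀ τ ∈ cones, (σ ⊓ τ).IsFaceOf σ

variable {N Q L : Type u} [AddCommGroup N] [AddCommGroup Q] [AddCommGroup L]

namespace Fan

/-- The diagram of the affine charts `Spec ℂ[σ^∨ ∩ N^∨]`, indexed by the cones of the fan ordered
by inclusion (equivalently, by the face relation). -/
def chartDiagram (F : Fan N) : F.cones ⥤ Scheme.{u} where
  obj σ := chart σ.1
  map f := chartIncl (leOfHom f)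
  map_id σ := chartIncl_refl σ.1
  map_comp f g := (chartIncl_trans (leOfHom g) (leOfHom f)).symm

theorem isFaceOf_of_le (F : Fan N) {σ τ : F.cones} (h : τ ≤ σ) : τ.1.IsFaceOf σ.1 := by
  have := F.inf_isFaceOf σ.1 σ.2 τ.1 τ.2
  rwa [inf_eq_right.2 h] at this

variable [Module.Free ℤ N] [Module.Finite ℤ N]

instance (F : Fan N) {τ σ : F.cones} (f : τ ⟶ σ) : IsOpenImmersion (F.chartDiagram.map f) := by
  obtain ⟨m, hm, hτ⟩ := exists_functional_of_isFaceOf (F.isRationalPolyhedral σ.1 σ.2)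
    (F.isFaceOf_of_le (leOfHom f))
  exact isOpenImmersion_chartIncl (F.isRationalPolyhedral σ.1 σ.2) (leOfHom f) hm hτ

instance (F : Fan N) : (F.chartDiagram ⋙ Scheme.forget).IsLocallyDirected where
  cond := by
    intro σ₁ σ₂ σ f₁ f₂ (x₁ : F.chartDiagram.obj σ₁) (x₂ : F.chartDiagram.obj σ₂) hx
    replace hx : F.chartDiagram.map f₁ x₁ = F.chartDiagram.map f₂ x₂ := hx
    have hσ := F.isRationalPolyhedral σ.1 σ.2
    obtain ⟨m₁, hm₁, h₁⟩ := exists_functional_of_isFaceOf hσ (F.isFaceOf_of_le (leOfHom f₁))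
    obtain ⟨m₂, hm₂, h₂⟩ := exists_functional_of_isFaceOf hσ (F.isFaceOf_of_le (leOfHom f₂))
    let τ : F.cones := ⟨σ₁.1 ⊓ σ₂.1,
      F.face_mem _ σ₁.2 _ (F.inf_isFaceOf _ σ₁.2 _ σ₂.2)⟩
    let g₁ : τ ⟶ σ₁ := homOfLE (inf_le_left : σ₁.1 ⊓ σ₂.1 ≤ σ₁.1)
    let g₂ : τ ⟶ σ₂ := homOfLE (inf_le_right : σ₁.1 ⊓ σ₂.1 ≤ σ₂.1)
    have hτσ : τ.1 ≤ σ.1 := leOfHom (g₁ ≫ f₁)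
    have hτ : ∀ x ∈ σ.1, x ∈ τ.1 ↔ evalR (m₁ + m₂) x = 0 := by
      intro x hx
      rw [evalR, map_add, LinearMap.add_apply]
      rw [add_eq_zero_iff_of_nonneg (hm₁ x hx) (hm₂ x hx), ← h₁ x hx, ← h₂ x hx]
      exact Submodule.mem_inf
    have r := range_chartIncl hσ hτσ ((dualMonoid σ.1).add_mem hm₁ hm₂) hτ
    have r₁ := range_chartIncl hσ (leOfHom f₁) hm₁ h₁
    have r₂ := range_chartIncl hσ (leOfHom f₂) hm₂ h₂
    have hy : F.chartDiagram.map f₁ x₁ ∈ Set.range (chartIncl hτσ) := by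
      rw [r]
      have e₁ : F.chartDiagram.map f₁ x₁ ∈ Set.range (chartIncl (leOfHom f₁)) := ⟨x₁, rfl⟩
      have e₂ : F.chartDiagram.map f₁ x₁ ∈ Set.range (chartIncl (leOfHom f₂)) := ⟨x₂, hx.symm⟩
      rw [r₁] at e₁
      rw [r₂] at e₂
      have : AddMonoidAlgebra.single (⟨m₁ + m₂, (dualMonoid σ.1).add_mem hm₁ hm₂⟩ :
          dualMonoid σ.1) (1 : ℂ) = AddMonoidAlgebra.single ⟨m₁, hm₁⟩ 1 *
            AddMonoidAlgebra.single ⟨m₂, hm₂⟩ 1 := by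
        rw [AddMonoidAlgebra.single_mul_single, mul_one]; rfl
      rw [this, PrimeSpectrum.basicOpen_mul]
      exact ⟨e₁, e₂⟩
    obtain ⟨z, hz⟩ := hy
    let z' : F.chartDiagram.obj τ := z
    refine ⟨τ, g₁, g₂, z', ?_, ?_⟩
    · apply (F.chartDiagram.map f₁).isOpenEmbedding.injective
      change (F.chartDiagram.map f₁) (F.chartDiagram.map g₁ z') = _
      rw [← Scheme.Hom.comp_apply, ← Functor.map_comp]
      exact hz
    · apply (F.chartDiagram.map f₂).isOpenEmbedding.injective
      change (F.chartDiagram.map f₂) (F.chartDiagram.map g₂ z') = _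
      rw [← Scheme.Hom.comp_apply, ← Functor.map_comp]
      exact hz.trans hx

/-- The geometric realization of `(F, N)`: the complex toric variety obtained by gluing the affine
charts `Spec ℂ[σ^∨ ∩ N^∨]`, for `σ ∈ F`, along the open subschemes given by the common faces. -/
def realization (F : Fan N) : Scheme.{u} := colimit F.chartDiagram

/-- The inclusion of an affine chart into the geometric realization. -/
def ι (F : Fan N) (σ : F.cones) : chart σ.1 ⟶ F.realization := colimit.ι F.chartDiagram σ

theorem chartIncl_ι (F : Fan N) {τ σ : F.cones} (h : τ.1 ≤ σ.1) :
    chartIncl h ≫ F.ι σ = F.ι τ := colimit.w F.chartDiagram (homOfLE h)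

end Fan

/-- A morphism of toric varieties `(F, N) → (G, Q)`: a homomorphism of lattices `p : N → Q` such
that `p_ℝ` takes each cone of `F` into a cone of `G`. -/
structure Fan.Hom (F : Fan N) (G : Fan Q) where
  toLinearMap : N →ₗ[ℤ] Q
  exists_cone : ∀ σ ∈ F.cones, ∃ κ ∈ G.cones, ∀ x ∈ σ, realMap toLinearMap x ∈ κ

namespace Fan.Hom

variable {F : Fan N} {G : Fan Q}

/-- Some cone of `G` into which `p` takes the cone `σ`. -/
def targetCone (p : F.Hom G) (σ : F.cones) : G.cones :=
  ⟨(p.exists_cone σ.1 σ.2).choose, (p.exists_cone σ.1 σ.2).choose_spec.1⟩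

theorem map_mem_targetCone (p : F.Hom G) (σ : F.cones) :
    ∀ x ∈ σ.1, realMap p.toLinearMap x ∈ (p.targetCone σ).1 :=
  (p.exists_cone σ.1 σ.2).choose_spec.2

section Realization

variable [Module.Free ℤ Q] [Module.Finite ℤ Q]

/-- The morphism from a chart of `(F, N)` to the realization of `(G, Q)` does not depend on the
choice of the target cone. -/
theorem chartMap_ι_eq (p : F.Hom G) {σ τ : F.cones} (h : τ.1 ≤ σ.1) (κ κ' : G.cones)
    (hκ : ∀ x ∈ σ.1, realMap p.toLinearMap x ∈ κ.1)
    (hκ' : ∀ x ∈ τ.1, realMap p.toLinearMap x ∈ κ'.1) :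
    chartIncl h ≫ chartMap p.toLinearMap hκ ≫ G.ι κ = chartMap p.toLinearMap hκ' ≫ G.ι κ' := by
  let ρ : G.cones := ⟨κ.1 ⊓ κ'.1, G.face_mem _ κ.2 _ (G.inf_isFaceOf _ κ.2 _ κ'.2)⟩
  have hρ : ∀ x ∈ τ.1, realMap p.toLinearMap x ∈ ρ.1 := fun x hx =>
    Submodule.mem_inf.2 ⟨hκ x (h hx), hκ' x hx⟩
  have h1 : G.ι ρ = chartIncl (inf_le_left : κ.1 ⊓ κ'.1 ≤ κ.1) ≫ G.ι κ :=
    (G.chartIncl_ι (τ := ρ) _).symm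
  have h2 : G.ι ρ = chartIncl (inf_le_right : κ.1 ⊓ κ'.1 ≤ κ'.1) ≫ G.ι κ' :=
    (G.chartIncl_ι (τ := ρ) _).symm
  have e1 : chartIncl h ≫ chartMap p.toLinearMap hκ ≫ G.ι κ =
      chartMap p.toLinearMap hρ ≫ G.ι ρ := by
    rw [h1, ← Category.assoc, ← Category.assoc, chartIncl_chartMap, chartMap_chartIncl]
  have e2 : chartMap p.toLinearMap hκ' ≫ G.ι κ' = chartMap p.toLinearMap hρ ≫ G.ι ρ := by
    rw [h2, ← Category.assoc, chartMap_chartIncl]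
  rw [e1, e2]

variable [Module.Free ℤ N] [Module.Finite ℤ N]

/-- The geometric realization of a morphism of toric varieties: on the chart of a cone `σ` which
is taken into a cone `κ`, it is given by the map `κ^∨ ∩ Q^∨ → σ^∨ ∩ N^∨`, `m ↦ m ∘ p`. -/
def realization (p : F.Hom G) : F.realization ⟶ G.realization :=
  colimit.desc F.chartDiagram
    { pt := G.realization
      ι :=
        { app := fun σ => chartMap p.toLinearMap (p.map_mem_targetCone σ) ≫ G.ι (p.targetCone σ)
          naturality := fun τ σ f => by
            exact (p.chartMap_ι_eq (leOfHom f) _ _ _ _).trans (Category.comp_id _).symm } }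

theorem ι_realization (p : F.Hom G) (σ : F.cones) (κ : G.cones)
    (h : ∀ x ∈ σ.1, realMap p.toLinearMap x ∈ κ.1) :
    F.ι σ ≫ p.realization = chartMap p.toLinearMap h ≫ G.ι κ := by
  refine (colimit.ι_desc _ σ).trans ?_
  have := p.chartMap_ι_eq (le_refl σ.1) κ (p.targetCone σ) h (p.map_mem_targetCone σ)
  rw [chartIncl_refl, Category.id_comp] at this
  exact this.symm

end Realization

/-- The monoid `N ∩ σ` of lattice points of a cone. -/
def _root_.Toric.latticePoints (σ : PointedCone ℝ (RealSpan N)) : AddSubmonoid N where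
  carrier := {n | (1 : ℝ) ⊗ₜ[ℤ] n ∈ σ}
  zero_mem' := by simp
  add_mem' {a b} ha hb := by
    rw [Set.mem_ofPred_eq, TensorProduct.tmul_add]; exact σ.add_mem ha hb

/-- Weak semistability: every cone of `F` surjects onto a cone of `G`, and whenever
`p(σ) = κ` one has `p(N ∩ σ) = Q ∩ κ`. -/
structure IsWeaklySemistable (p : F.Hom G) : Prop where
  map_cone_mem : ∀ σ ∈ F.cones, σ.map (realMap p.toLinearMap) ∈ G.cones
  map_latticePoints : ∀ σ ∈ F.cones, ∀ κ ∈ G.cones, σ.map (realMap p.toLinearMap) = κ →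
    (latticePoints σ).map p.toLinearMap = latticePoints κ

end Fan.Hom

section FiberProduct

/-- The fiber product `N ×_Q L` of lattices. -/
abbrev fiberLattice (p : N →ₗ[ℤ] Q) (q : L →ₗ[ℤ] Q) : Submodule ℤ (N × L) :=
  LinearMap.eqLocus (p ∘ₗ LinearMap.fst ℤ N L) (q ∘ₗ LinearMap.snd ℤ N L)

/-- The first projection `N ×_Q L → N`. -/
abbrev fiberFst (p : N →ₗ[ℤ] Q) (q : L →ₗ[ℤ] Q) : fiberLattice p q →ₗ[ℤ] N :=
  LinearMap.fst ℤ N L ∘ₗ (fiberLattice p q).subtype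

/-- The second projection `N ×_Q L → L`. -/
abbrev fiberSnd (p : N →ₗ[ℤ] Q) (q : L →ₗ[ℤ] Q) : fiberLattice p q →ₗ[ℤ] L :=
  LinearMap.snd ℤ N L ∘ₗ (fiberLattice p q).subtype

/-- The cone `σ ×_κ λ` in `(N ×_Q L)_ℝ = N_ℝ ×_{Q_ℝ} L_ℝ`, consisting of the vectors whose
projections lie in `σ` and in `λ`. -/
def fiberCone (p : N →ₗ[ℤ] Q) (q : L →ₗ[ℤ] Q) (σ : PointedCone ℝ (RealSpan N))
    (τ : PointedCone ℝ (RealSpan L)) : PointedCone ℝ (RealSpan (fiberLattice p q)) :=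
  σ.comap (realMap (fiberFst p q)) ⊓ τ.comap (realMap (fiberSnd p q))

theorem fiber_ext (p : N →ₗ[ℤ] Q) (q : L →ₗ[ℤ] Q) (x : RealSpan (fiberLattice p q))
    (h1 : realMap (fiberFst p q) x = 0) (h2 : realMap (fiberSnd p q) x = 0) : x = 0 := by
  have hinj : Function.Injective (realMap (fiberLattice p q).subtype) :=
    Module.Flat.lTensor_preserves_injective_linearMap (M := ℝ) _ Subtype.val_injective
  apply hinj
  rw [map_zero]
  have key : ∀ y : RealSpan (N × L), y = realMap (LinearMap.inl ℤ N L)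
      (realMap (LinearMap.fst ℤ N L) y) + realMap (LinearMap.inr ℤ N L)
      (realMap (LinearMap.snd ℤ N L) y) := by
    intro y
    induction y using TensorProduct.induction_on with
    | zero => simp
    | tmul r n =>
      simp only [realMap, LinearMap.baseChange_tmul, ← TensorProduct.tmul_add]
      simp
    | add y z hy hz =>
      rw [map_add, map_add, map_add, map_add]
      nth_rw 1 [hy, hz]
      abel
  have e1 : realMap (LinearMap.fst ℤ N L) (realMap (fiberLattice p q).subtype x) = 0 := by
    rw [← h1]; simp [LinearMap.baseChange_comp]
  have e2 : realMap (LinearMap.snd ℤ N L) (realMap (fiberLattice p q).subtype x) = 0 := by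
    rw [← h2]; simp [LinearMap.baseChange_comp]
  rw [key (realMap (fiberLattice p q).subtype x), e1, e2]
  simp

theorem mem_fiberCone {p : N →ₗ[ℤ] Q} {q : L →ₗ[ℤ] Q} {σ : PointedCone ℝ (RealSpan N)}
    {τ : PointedCone ℝ (RealSpan L)} {x : RealSpan (fiberLattice p q)} :
    x ∈ fiberCone p q σ τ ↔ realMap (fiberFst p q) x ∈ σ ∧ realMap (fiberSnd p q) x ∈ τ :=
  Iff.rfl

theorem isRationalPolyhedral_fiberCone [Module.Free ℤ N] [Module.Finite ℤ N] [Module.Free ℤ L]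
    [Module.Finite ℤ L] (p : N →ₗ[ℤ] Q) (q : L →ₗ[ℤ] Q) {σ : PointedCone ℝ (RealSpan N)}
    {τ : PointedCone ℝ (RealSpan L)} (hσ : IsRationalPolyhedral σ) (hτ : IsRationalPolyhedral τ) :
    IsRationalPolyhedral (fiberCone p q σ τ) := by
  classical
  obtain ⟨s, rfl⟩ := hσ
  obtain ⟨s', rfl⟩ := hτ
  obtain ⟨t, ht⟩ := exists_functionals s
  obtain ⟨t', ht'⟩ := exists_functionals s'
  refine isRationalPolyhedral_of_functionals
    (t.image (fun m => m ∘ₗ fiberFst p q) ∪ t'.image fun m => m ∘ₗ fiberSnd p q) _ fun x => ?_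
  rw [mem_fiberCone, ht, ht']
  constructor
  · rintro ⟨h1, h2⟩ m hm
    rcases Finset.mem_union.1 hm with hm | hm <;> obtain ⟨l, hl, rfl⟩ := Finset.mem_image.1 hm
    · rw [evalR_comp]; exact h1 l hl
    · rw [evalR_comp]; exact h2 l hl
  · refine fun h => ⟨fun m hm => ?_, fun m hm => ?_⟩
    · rw [← evalR_comp]
      exact h _ (Finset.mem_union_left _ (Finset.mem_image_of_mem _ hm))
    · rw [← evalR_comp]
      exact h _ (Finset.mem_union_right _ (Finset.mem_image_of_mem _ hm))

/-- The smallest face of `σ` containing the image of a cone `T` which is mapped into `σ`. -/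
def minFace {V W : Type*} [AddCommGroup V] [Module ℝ V] [AddCommGroup W] [Module ℝ W]
    (f : V →ₗ[ℝ] W) (T : PointedCone ℝ V) (σ : PointedCone ℝ W) : PointedCone ℝ W where
  carrier := {x | x ∈ σ ∧ ∃ y ∈ σ, ∃ t ∈ T, x + y = f t}
  zero_mem' := ⟨σ.zero_mem, 0, σ.zero_mem, 0, T.zero_mem, by simp⟩
  add_mem' := by
    rintro a b ⟨ha, y, hy, t, ht, e⟩ ⟨hb, y', hy', t', ht', e'⟩
    refine ⟨σ.add_mem ha hb, y + y', σ.add_mem hy hy', t + t', T.add_mem ht ht', ?_⟩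
    rw [map_add, ← e, ← e']; abel
  smul_mem' := by
    rintro c a ⟨ha, y, hy, t, ht, e⟩
    refine ⟨Submodule.smul_mem σ c ha, c • y, Submodule.smul_mem σ c hy, c • t,
      Submodule.smul_mem T c ht, ?_⟩
    have : f (c • t) = c • f t := map_smul f (c : ℝ) t
    rw [this, ← e, smul_add]

theorem isFaceOf_minFace {V W : Type*} [AddCommGroup V] [Module ℝ V] [AddCommGroup W] [Module ℝ W]
    (f : V →ₗ[ℝ] W) (T : PointedCone ℝ V) (σ : PointedCone ℝ W) : (minFace f T σ).IsFaceOf σ where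
  le := fun _ h => h.1
  mem_of_smul_add_mem := by
    rintro x y a hx hy ha ⟨-, z, hz, t, ht, e⟩
    refine ⟨hx, a⁻¹ • (y + z), PointedCone.smul_mem _ (inv_nonneg.2 ha.le) (σ.add_mem hy hz),
      a⁻¹ • t, PointedCone.smul_mem _ (inv_nonneg.2 ha.le) ht, ?_⟩
    rw [map_smul, ← e, smul_add, smul_add, smul_add, smul_smul, inv_mul_cancel₀ ha.ne', one_smul,
      add_assoc]

theorem eq_fiberCone_of_isFaceOf (p : N →ₗ[ℤ] Q) (q : L →ₗ[ℤ] Q) {σ : PointedCone ℝ (RealSpan N)}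
    {τ : PointedCone ℝ (RealSpan L)} {T : PointedCone ℝ (RealSpan (fiberLattice p q))}
    (hT : T.IsFaceOf (fiberCone p q σ τ)) :
    T = fiberCone p q (minFace (realMap (fiberFst p q)) T σ)
      (minFace (realMap (fiberSnd p q)) T τ) := by
  refine le_antisymm (fun x hx => ?_) fun x hx => ?_
  · obtain ⟨h1, h2⟩ := mem_fiberCone.1 (hT.le hx)
    exact ⟨⟨h1, 0, σ.zero_mem, x, hx, by simp⟩, ⟨h2, 0, τ.zero_mem, x, hx, by simp⟩⟩
  · obtain ⟨⟨h1, y, hy, t, ht, e⟩, ⟨h2, y', hy', t', ht', e'⟩⟩ := mem_fiberCone.1 hx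
    have hz : t + t' - x ∈ fiberCone p q σ τ := by
      refine mem_fiberCone.2 ⟨?_, ?_⟩
      · have : realMap (fiberFst p q) (t + t' - x) = y + realMap (fiberFst p q) t' := by
          rw [map_sub, map_add, ← e]; abel
        rw [this]
        exact σ.add_mem hy (mem_fiberCone.1 (hT.le ht')).1
      · have : realMap (fiberSnd p q) (t + t' - x) = y' + realMap (fiberSnd p q) t := by
          rw [map_sub, map_add, ← e']; abel
        rw [this]
        exact τ.add_mem hy' (mem_fiberCone.1 (hT.le ht)).2
    refine hT.mem_of_add_mem_left (mem_fiberCone.2 ⟨h1, h2⟩) hz ?_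
    rw [add_sub_cancel]
    exact T.add_mem ht ht'

variable {F : Fan N} {G : Fan Q} {H : Fan L}
variable [Module.Free ℤ N] [Module.Finite ℤ N] [Module.Free ℤ L] [Module.Finite ℤ L]

/-- The toric fiber product: the fan of all cones `σ ×_κ λ`, for `σ ∈ F`, `λ ∈ H` and `κ ∈ G` such
that `σ` and `λ` are taken into `κ`, in the lattice `N ×_Q L`. -/
def Fan.fiberProduct (p : F.Hom G) (q : H.Hom G) :
    Fan (fiberLattice p.toLinearMap q.toLinearMap) where
  cones := {C | ∃ σ ∈ F.cones, ∃ τ ∈ H.cones, ∃ κ ∈ G.cones,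
    (∀ x ∈ σ, realMap p.toLinearMap x ∈ κ) ∧ (∀ y ∈ τ, realMap q.toLinearMap y ∈ κ) ∧
    C = fiberCone p.toLinearMap q.toLinearMap σ τ}
  finite_cones := by
    refine ((F.finite_cones.prod H.finite_cones).image
      fun P => fiberCone p.toLinearMap q.toLinearMap P.1 P.2).subset ?_
    rintro _ ⟨σ, hσ, τ, hτ, -, -, -, -, rfl⟩
    exact ⟨(σ, τ), ⟨hσ, hτ⟩, rfl⟩
  isRationalPolyhedral := by
    rintro _ ⟨σ, hσ, τ, hτ, -, -, -, -, rfl⟩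
    exact isRationalPolyhedral_fiberCone _ _ (F.isRationalPolyhedral σ hσ)
      (H.isRationalPolyhedral τ hτ)
  stronglyConvex := by
    rintro _ ⟨σ, hσ, τ, hτ, -, -, -, -, rfl⟩ x hx hx'
    obtain ⟨h1, h2⟩ := mem_fiberCone.1 hx
    obtain ⟨h1', h2'⟩ := mem_fiberCone.1 hx'
    rw [map_neg] at h1' h2'
    exact fiber_ext _ _ x (F.stronglyConvex σ hσ _ h1 h1') (H.stronglyConvex τ hτ _ h2 h2')
  face_mem := by
    rintro _ ⟨σ, hσ, τ, hτ, κ, hκ, h1, h2, rfl⟩ T hT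
    have f1 := isFaceOf_minFace (realMap (fiberFst p.toLinearMap q.toLinearMap)) T σ
    have f2 := isFaceOf_minFace (realMap (fiberSnd p.toLinearMap q.toLinearMap)) T τ
    exact ⟨_, F.face_mem σ hσ _ f1, _, H.face_mem τ hτ _ f2, κ, hκ, fun x hx => h1 x (f1.le hx),
      fun x hx => h2 x (f2.le hx), eq_fiberCone_of_isFaceOf _ _ hT⟩
  inf_isFaceOf := by
    rintro _ ⟨σ, hσ, τ, hτ, -, -, -, -, rfl⟩ _ ⟨σ', hσ', τ', hτ', -, -, -, -, rfl⟩
    refine ⟨inf_le_left, fun {x y a} hx hy ha h => ?_⟩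
    obtain ⟨-, h⟩ := Submodule.mem_inf.1 h
    obtain ⟨h1, h2⟩ := mem_fiberCone.1 h
    obtain ⟨x1, x2⟩ := mem_fiberCone.1 hx
    obtain ⟨y1, y2⟩ := mem_fiberCone.1 hy
    rw [map_add, map_smul] at h1 h2
    refine Submodule.mem_inf.2 ⟨hx, mem_fiberCone.2 ⟨?_, ?_⟩⟩
    · exact (Submodule.mem_inf.1 ((F.inf_isFaceOf σ hσ σ' hσ').mem_of_smul_add_mem x1 y1 ha
        (Submodule.mem_inf.2 ⟨σ.add_mem (PointedCone.smul_mem _ ha.le x1) y1, h1⟩))).2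
    · exact (Submodule.mem_inf.1 ((H.inf_isFaceOf τ hτ τ' hτ').mem_of_smul_add_mem x2 y2 ha
        (Submodule.mem_inf.2 ⟨τ.add_mem (PointedCone.smul_mem _ ha.le x2) y2, h2⟩))).2

/-- The first projection of the toric fiber product. -/
def Fan.fiberProductFst (p : F.Hom G) (q : H.Hom G) : (Fan.fiberProduct p q).Hom F where
  toLinearMap := fiberFst p.toLinearMap q.toLinearMap
  exists_cone := by
    rintro _ ⟨σ, hσ, τ, hτ, -, -, -, -, rfl⟩
    exact ⟨σ, hσ, fun x hx => (mem_fiberCone.1 hx).1⟩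

/-- The second projection of the toric fiber product. -/
def Fan.fiberProductSnd (p : F.Hom G) (q : H.Hom G) : (Fan.fiberProduct p q).Hom H where
  toLinearMap := fiberSnd p.toLinearMap q.toLinearMap
  exists_cone := by
    rintro _ ⟨σ, hσ, τ, hτ, -, -, -, -, rfl⟩
    exact ⟨τ, hτ, fun x hx => (mem_fiberCone.1 hx).2⟩

end FiberProduct

end Fans

end

end Toric

/-! Everything reduces to charts. For `σ` in `F`, `κ = p(σ)` and a cone `τ` with `q(τ) ⊆ κ`, the
coordinate ring of `σ ×_κ τ` has to be the tensor product of those of `σ` and `τ` over that of `κ`;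
equivalently, the dual monoid of the fiber cone has to be the amalgamated sum of `σ^∨` and `τ^∨`
over `κ^∨`.

The lemma that carries this is `exists_normalized`. A functional `a` that is nonnegative on the
fibre of `σ` over `0` has a minimum on the fibre over an interior point of `κ`, and linear
programming duality (`exists_certificate`) turns this into a functional `c • a + m ∘ p` in `σ^∨`
that vanishes at a point over the interior point. The image of its zero face is a cone of `G` inside
`κ`, hence a face of `κ`, and it contains an interior point, so it is `κ`. As the lattice points of
that zero face surject onto those of `κ`, `m` is divisible by `c` on `κ`, and the certificate
becomes integral: `a = b + u ∘ p`, where `b` lies in `σ^∨` and vanishes somewhere on every fibre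
over `κ`. Such a normal form gives both halves of the amalgamated sum: functionals on the fiber cone
decompose (`exists_add_of_mem_dualMonoid_fiberCone`), and two decompositions differ by elements of
`κ^∨` (`mul_eq_mul_of_fiberLattice_eq`).

To globalize, compare the toric fiber product with the scheme-theoretic pullback. The charts of the
pairs with `q(τ) ⊆ p(σ)` embed as open subschemes of the pullback. They cover it because every point
of a toric variety has a least chart, and they are the full preimages of their images, so the
comparison map is an isomorphism.

Weak semistability of the projection follows from the formula for the image of a fiber cone, `τ ∩
q⁻¹(p(σ))`, which is a face of `τ`. -/

namespace Toric

/-! ### Lattice points of cones, linear programming duality and normalized functionals. -/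

section LatticeCones

variable {N Q L : Type u} [AddCommGroup N] [AddCommGroup Q] [AddCommGroup L]

theorem realMap_realMap (p : N →ₗ[ℤ] Q) (q : Q →ₗ[ℤ] L) (x : RealSpan N) :
    realMap q (realMap p x) = realMap (q ∘ₗ p) x := by
  rw [realMap, realMap, realMap, LinearMap.baseChange_comp]; rfl

theorem evalR_add (m m' : Module.Dual ℤ N) (x : RealSpan N) :
    evalR (m + m') x = evalR m x + evalR m' x := by
  rw [evalR, map_add]; rfl

theorem evalR_sub (m m' : Module.Dual ℤ N) (x : RealSpan N) :
    evalR (m - m') x = evalR m x - evalR m' x := by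
  rw [evalR, map_sub]; rfl

theorem evalR_zero (x : RealSpan N) : evalR (0 : Module.Dual ℤ N) x = 0 := by
  rw [evalR, map_zero]; rfl

/-- `(N ×_Q L)_ℝ` surjects onto `N_ℝ ×_{Q_ℝ} L_ℝ`. -/
theorem exists_realSpan_fiberLattice (p : N →ₗ[ℤ] Q) (q : L →ₗ[ℤ] Q) {x : RealSpan N}
    {z : RealSpan L} (h : realMap p x = realMap q z) :
    ∃ w : RealSpan (fiberLattice p q),
      realMap (fiberFst p q) w = x ∧ realMap (fiberSnd p q) w = z := by
  -- The fiber lattice is the kernel of `p ∘ fst - q ∘ snd`, and tensoring with the flat module `ℝ`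
  -- preserves this.
  have hex : Function.Exact (fiberLattice p q).subtype
      (p ∘ₗ LinearMap.fst ℤ N L - q ∘ₗ LinearMap.snd ℤ N L) := by
    intro y
    rw [LinearMap.sub_apply, sub_eq_zero, ← LinearMap.mem_eqLocus]
    simp
  have hex' := Module.Flat.lTensor_exact ℝ hex
  let y : RealSpan (N × L) :=
    realMap (LinearMap.inl ℤ N L) x + realMap (LinearMap.inr ℤ N L) z
  have e1 : realMap (LinearMap.fst ℤ N L) y = x := by
    simp only [y, map_add, realMap_realMap, LinearMap.fst_comp_inl, LinearMap.fst_comp_inr]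
    simp
  have e2 : realMap (LinearMap.snd ℤ N L) y = z := by
    simp only [y, map_add, realMap_realMap, LinearMap.snd_comp_inl, LinearMap.snd_comp_inr]
    simp
  obtain ⟨w, hw⟩ := (hex' y).1 (by
    change realMap (p ∘ₗ LinearMap.fst ℤ N L - q ∘ₗ LinearMap.snd ℤ N L) y = 0
    rw [realMap, LinearMap.baseChange_sub, LinearMap.sub_apply, sub_eq_zero,
      ← realMap_realMap, ← realMap_realMap, e1, e2, h])
  replace hw : realMap (fiberLattice p q).subtype w = y := hw
  exact ⟨w, by rw [← realMap_realMap, hw, e1], by rw [← realMap_realMap, hw, e2]⟩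

theorem mem_latticePoints {σ : PointedCone ℝ (RealSpan N)} {n : N} :
    n ∈ latticePoints σ ↔ (1 : ℝ) ⊗ₜ[ℤ] n ∈ σ := Iff.rfl

theorem one_tmul_zsmul (k : ℤ) (n : N) : (1 : ℝ) ⊗ₜ[ℤ] (k • n) = (k : ℝ) • ((1 : ℝ) ⊗ₜ[ℤ] n) := by
  rw [TensorProduct.tmul_smul, Int.cast_smul_eq_zsmul]

theorem IsRationalPolyhedral.eq_hull_latticePoints {σ : PointedCone ℝ (RealSpan N)}
    (hσ : IsRationalPolyhedral σ) :
    σ = PointedCone.hull ℝ ((fun n : N => (1 : ℝ) ⊗ₜ[ℤ] n) '' (latticePoints σ : Set N)) := by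
  obtain ⟨s, hs⟩ := hσ
  refine le_antisymm ?_ (Submodule.span_le.2 ?_)
  · nth_rw 1 [hs]
    refine Submodule.span_mono (Set.image_mono fun n hn => ?_)
    rw [SetLike.mem_coe, mem_latticePoints, hs]
    exact Submodule.subset_span ⟨n, hn, rfl⟩
  · rintro _ ⟨n, hn, rfl⟩
    exact hn

/-- A functional which is nonnegative on the lattice points of a rational cone is nonnegative on
the cone. -/
theorem IsRationalPolyhedral.evalR_nonneg {σ : PointedCone ℝ (RealSpan N)}
    (hσ : IsRationalPolyhedral σ) {m : Module.Dual ℤ N} (h : ∀ n ∈ latticePoints σ, 0 ≤ m n) :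
    ∀ x ∈ σ, 0 ≤ evalR m x := by
  intro x hx
  rw [hσ.eq_hull_latticePoints] at hx
  induction hx using Submodule.span_induction with
  | mem y hy =>
    obtain ⟨n, hn, rfl⟩ := hy
    simpa using h n hn
  | zero => simp
  | add y z _ _ hy hz => rw [map_add]; exact add_nonneg hy hz
  | smul a y _ hy =>
    have : evalR m (a • y) = (a : ℝ) • evalR m y := map_smul (evalR m) (a : ℝ) y
    rw [this]
    exact mul_nonneg a.2 hy

/-- The subgroup generated by the lattice points of a cone. -/
def latticeSpan (κ : PointedCone ℝ (RealSpan Q)) : Submodule ℤ Q :=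
  AddSubgroup.toIntSubmodule
    { carrier := {y | ∃ a ∈ latticePoints κ, ∃ b ∈ latticePoints κ, y = a - b}
      zero_mem' := ⟨0, zero_mem _, 0, zero_mem _, by simp⟩
      add_mem' := by
        rintro _ _ ⟨a, ha, b, hb, rfl⟩ ⟨a', ha', b', hb', rfl⟩
        exact ⟨a + a', add_mem ha ha', b + b', add_mem hb hb', by abel⟩
      neg_mem' := by
        rintro _ ⟨a, ha, b, hb, rfl⟩
        exact ⟨b, hb, a, ha, by abel⟩ }

theorem mem_latticeSpan {κ : PointedCone ℝ (RealSpan Q)} {y : Q} :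
    y ∈ latticeSpan κ ↔ ∃ a ∈ latticePoints κ, ∃ b ∈ latticePoints κ, y = a - b := Iff.rfl

theorem mem_latticePoints_of_nsmul {κ : PointedCone ℝ (RealSpan Q)} {k : ℕ} (hk : 0 < k) {y : Q}
    (h : k • y ∈ latticePoints κ) : y ∈ latticePoints κ := by
  rw [mem_latticePoints] at *
  have e : (1 : ℝ) ⊗ₜ[ℤ] y = (k : ℝ)⁻¹ • ((1 : ℝ) ⊗ₜ[ℤ] (k • y)) := by
    rw [← natCast_zsmul, one_tmul_zsmul, smul_smul]
    have : (k : ℝ) ≠ 0 := by positivity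
    simp [this]
  rw [e]
  exact PointedCone.smul_mem _ (by positivity) h

/-- The span of the lattice points is saturated because a cone is stable under division by positive
integers. This makes the quotient torsion-free, hence free, in `exists_eq_smul_on_latticePoints`. -/
theorem mem_latticeSpan_of_zsmul {κ : PointedCone ℝ (RealSpan Q)} {k : ℤ} (hk : k ≠ 0) {y : Q}
    (h : k • y ∈ latticeSpan κ) : y ∈ latticeSpan κ := by
  have h' : k.natAbs • y ∈ latticeSpan κ := by
    rcases Int.natAbs_eq k with e | e
    · rwa [e, natCast_zsmul] at h
    · rw [e, neg_smul, natCast_zsmul] at h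
      exact (Submodule.neg_mem_iff _).1 h
  obtain ⟨a, ha, b, hb, e⟩ := mem_latticeSpan.1 h'
  obtain ⟨j, hj⟩ := Nat.exists_eq_succ_of_ne_zero (Int.natAbs_ne_zero.2 hk)
  rw [hj] at e
  -- With `|k| = j + 1` and `|k| y = a - b`, one has `|k| (y + b) = a + j b`, which lies in the
  -- cone.
  refine mem_latticeSpan.2 ⟨y + b, ?_, b, hb, by abel⟩
  refine mem_latticePoints_of_nsmul j.succ_pos ?_
  have : j.succ • (y + b) = a + j • b := by
    rw [smul_add, e, succ_nsmul]; abel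
  rw [this]
  exact add_mem ha (nsmul_mem hb j)

/-- An integral functional which is divisible by `c` on the lattice points of a cone agrees there
with `c` times an integral functional. -/
theorem exists_eq_smul_on_latticePoints [Module.Finite ℤ Q]
    {κ : PointedCone ℝ (RealSpan Q)} (m : Module.Dual ℤ Q) (c : ℤ)
    (h : ∀ y ∈ latticePoints κ, c ∣ m y) :
    ∃ u : Module.Dual ℤ Q, ∀ y ∈ latticePoints κ, m y = c * u y := by
  by_cases hc : c = 0
  · exact ⟨0, fun y hy => by have := h y hy; rw [hc, zero_dvd_iff] at this; simp [this]⟩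
  have hsat : Module.IsTorsionFree ℤ (Q ⧸ latticeSpan κ) := by
    refine Module.IsTorsionFree.of_smul_eq_zero fun k v hv => ?_
    obtain ⟨y, rfl⟩ := Submodule.mkQ_surjective _ v
    rw [← map_smul] at hv
    simp only [Submodule.mkQ_apply, Submodule.Quotient.mk_eq_zero] at hv ⊢
    exact or_iff_not_imp_left.2 fun hk => mem_latticeSpan_of_zsmul hk hv
  have : Module.Free ℤ (Q ⧸ latticeSpan κ) := inferInstance
  -- A splitting of the quotient gives a projection `y ↦ y - s [y]` onto the span, where `m` is
  -- divisible by `c`. The functional sought is `m (y - s [y]) / c`.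
  obtain ⟨s, hs⟩ := Module.projective_lifting_property (latticeSpan κ).mkQ LinearMap.id
    (Submodule.mkQ_surjective _)
  have hr : ∀ y, y - s ((latticeSpan κ).mkQ y) ∈ latticeSpan κ := fun y => by
    rw [← Submodule.Quotient.mk_eq_zero, ← Submodule.mkQ_apply, map_sub, sub_eq_zero]
    exact (LinearMap.congr_fun hs _).symm
  have hdvd : ∀ y ∈ latticeSpan κ, c ∣ m y := by
    rintro _ ⟨a, ha, b, hb, rfl⟩
    rw [map_sub]
    exact dvd_sub (h a ha) (h b hb)
  choose f hf using fun y => hdvd _ (hr y)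
  refine ⟨{ toFun := f, map_add' := fun x y => ?_, map_smul' := fun k x => ?_ }, fun y hy => ?_⟩
  · apply mul_left_cancel₀ hc
    rw [← hf, mul_add, ← hf, ← hf, ← map_add]
    congr 1
    simp only [map_add]
    abel
  · apply mul_left_cancel₀ hc
    rw [← hf, map_smul, map_smul, ← smul_sub, map_smul, hf]
    simp only [smul_eq_mul, RingHom.id_apply]
    ring
  · have : (latticeSpan κ).mkQ y = 0 := by
      rw [← LinearMap.mem_ker, Submodule.ker_mkQ]
      exact mem_latticeSpan.2 ⟨y, hy, 0, zero_mem _, by simp⟩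
    have h2 := hf y
    rw [this, map_zero, sub_zero] at h2
    exact h2

/-- Linear programming duality: the minimum of the functional `a` on the fibre of `σ` over the
image of `x₁` is certified by an integral functional. -/
theorem exists_certificate [Module.Free ℤ Q] [Module.Finite ℤ Q] {σ : PointedCone ℝ (RealSpan N)}
    (hσ : IsRationalPolyhedral σ) (p : N →ₗ[ℤ] Q) (a : Module.Dual ℤ N)
    (ha : ∀ x ∈ σ, realMap p x = 0 → 0 ≤ evalR a x) {x₁ : RealSpan N} (hx₁ : x₁ ∈ σ) :
    ∃ (m : Module.Dual ℤ Q) (c : ℤ), 0 < c ∧ c • a + m ∘ₗ p ∈ dualMonoid σ ∧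
      ∃ x₀ ∈ σ, realMap p x₀ = realMap p x₁ ∧ evalR (c • a + m ∘ₗ p) x₀ = 0 := by
  classical
  obtain ⟨s, rfl⟩ := hσ
  set σ := PointedCone.hull ℝ ((fun n : N => (1 : ℝ) ⊗ₜ[ℤ] n) '' (s : Set N)) with hσ
  -- The image of `σ` under `(p, a)` records the values of `a` on each fibre. Each of its finitely
  -- many inequalities `l` splits into a part `M l` on `Q` and a coefficient `C l` of the value;
  -- those with `C l > 0` are lower bounds for `a`.
  let r : N →ₗ[ℤ] Q × ℤ := p.prod a
  obtain ⟨t, ht⟩ := exists_functionals (s.image r)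
  have hmap : PointedCone.hull ℝ ((fun n : Q × ℤ => (1 : ℝ) ⊗ₜ[ℤ] n) '' (s.image r : Finset _)) =
      σ.map (realMap r) := by
    rw [hσ, PointedCone.hull, PointedCone.hull, PointedCone.map, Submodule.map_span,
      Finset.coe_image, ← Set.image_comp]
    refine congrArg _ ((Set.image_congr fun n _ => ?_).trans (Set.image_comp _ _ _))
    simp
  let M : Module.Dual ℤ (Q × ℤ) → Module.Dual ℤ Q := fun l => l ∘ₗ LinearMap.inl ℤ Q ℤ
  let C : Module.Dual ℤ (Q × ℤ) → ℤ := fun l => l (0, 1)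
  have hMC : ∀ l : Module.Dual ℤ (Q × ℤ), l ∘ₗ r = C l • a + M l ∘ₗ p := fun l => by
    ext n
    have : r n = (p n, 0) + a n • ((0, 1) : Q × ℤ) := by simp [r]
    simp only [LinearMap.comp_apply, this, map_add, map_smul, LinearMap.add_apply,
      LinearMap.smul_apply, M, C, LinearMap.inl_apply, smul_eq_mul]
    ring
  have key : ∀ l x, evalR l (realMap r x) = C l * evalR a x + evalR (M l) (realMap p x) :=
    fun l x => by rw [← evalR_comp, hMC, evalR_add, evalR_smul, evalR_comp]
  have key' : ∀ l x, evalR (C l • a + M l ∘ₗ p) x =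
      C l * evalR a x + evalR (M l) (realMap p x) :=
    fun l x => by rw [evalR_add, evalR_smul, evalR_comp]
  let v : RealSpan Q → ℝ → RealSpan (Q × ℤ) := fun y b =>
    realMap (LinearMap.inl ℤ Q ℤ) y + b • (1 : ℝ) ⊗ₜ[ℤ] ((0, 1) : Q × ℤ)
  have hv : ∀ l y b, evalR l (v y b) = evalR (M l) y + C l * b := fun l y b => by
    simp only [v, M, C, map_add, map_smul, evalR_comp, evalR_tmul, smul_eq_mul]
    ring
  have hvmem : ∀ y b, (∀ l ∈ t, 0 ≤ evalR l (v y b)) →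
      ∃ x ∈ σ, realMap p x = y ∧ evalR a x = b := by
    intro y b h
    rw [← ht, hmap] at h
    obtain ⟨x, hx, e⟩ := PointedCone.mem_map.1 h
    refine ⟨x, hx, ?_, ?_⟩
    · have := congrArg (realMap (LinearMap.fst ℤ Q ℤ)) e
      rw [realMap_realMap, LinearMap.fst_prod] at this
      rw [this]
      simp only [v, map_add, map_smul, realMap_realMap, LinearMap.fst_comp_inl]
      simp
    · have := congrArg (evalR (LinearMap.snd ℤ Q ℤ)) e
      rw [← evalR_comp, LinearMap.snd_prod] at this
      rw [this]
      simp only [v, map_add, map_smul, ← evalR_comp, LinearMap.snd_comp_inl, evalR_zero]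
      simp
  have hnn : ∀ x ∈ σ, ∀ l ∈ t, 0 ≤ C l * evalR a x + evalR (M l) (realMap p x) := by
    intro x hx l hl
    rw [← key]
    exact (ht _).1 (hmap ▸ PointedCone.mem_map.2 ⟨x, hx, rfl⟩) l hl
  -- Without a lower bound, `(0, -1)` would satisfy all inequalities, so `a` would take the value
  -- `-1` on the fibre over `0`.
  have hpos : (t.filter fun l => 0 < C l).Nonempty := by
    by_contra hne
    rw [Finset.not_nonempty_iff_eq_empty, Finset.filter_eq_empty_iff] at hne
    obtain ⟨x, hx, e1, e2⟩ := hvmem 0 (-1) fun l hl => by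
      have : (C l : ℝ) ≤ 0 := by exact_mod_cast not_lt.1 (hne hl)
      rw [hv, map_zero]
      linarith
    have := ha x hx e1
    linarith
  -- The sharpest lower bound over `p(x₁)`; its value `b` is the minimum of `a` on that fibre.
  obtain ⟨l, hl, hmax⟩ := Finset.exists_max_image _
    (fun l => -evalR (M l) (realMap p x₁) / C l) hpos
  obtain ⟨hlt, hlC⟩ := Finset.mem_filter.1 hl
  have hlC' : (0 : ℝ) < C l := by exact_mod_cast hlC
  set b := -evalR (M l) (realMap p x₁) / C l with hb
  have hbl : C l * b = -evalR (M l) (realMap p x₁) := by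
    rw [hb, mul_div_cancel₀ _ hlC'.ne']
  have hb₁ : b ≤ evalR a x₁ := by
    have := hnn x₁ hx₁ l hlt
    rw [hb, div_le_iff₀ hlC']
    linarith
  -- The minimum is attained: `b` meets the lower bounds by maximality, and the other inequalities
  -- because `b ≤ a(x₁)` and `x₁` already satisfies them.
  obtain ⟨x₀, hx₀, e1, e2⟩ := hvmem (realMap p x₁) b fun l' hl' => by
    rw [hv]
    rcases lt_or_ge 0 (C l') with h | h
    · have h1 := hmax l' (Finset.mem_filter.2 ⟨hl', h⟩)
      have h2 : (0 : ℝ) < C l' := by exact_mod_cast h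
      rw [div_le_iff₀ h2] at h1
      linarith
    · have h1 := hnn x₁ hx₁ l' hl'
      have h2 : (C l' : ℝ) ≤ 0 := by exact_mod_cast h
      have := mul_le_mul_of_nonpos_left hb₁ h2
      linarith
  refine ⟨M l, C l, hlC, fun x hx => ?_, x₀, hx₀, e1, ?_⟩
  · rw [key']; exact hnn x hx l hlt
  · rw [key', e1, e2, hbl]; ring

/-- The face of a cone on which a nonnegative functional vanishes. -/
def zeroFace (σ : PointedCone ℝ (RealSpan N)) (m : Module.Dual ℤ N) :
    PointedCone ℝ (RealSpan N) :=
  σ ⊓ PointedCone.ofSubmodule (LinearMap.ker (evalR m))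

theorem mem_zeroFace {σ : PointedCone ℝ (RealSpan N)} {m : Module.Dual ℤ N} {x : RealSpan N} :
    x ∈ zeroFace σ m ↔ x ∈ σ ∧ evalR m x = 0 := Iff.rfl

theorem isFaceOf_zeroFace {σ : PointedCone ℝ (RealSpan N)} {m : Module.Dual ℤ N}
    (hm : m ∈ dualMonoid σ) : (zeroFace σ m).IsFaceOf σ where
  le := inf_le_left
  mem_of_smul_add_mem := by
    intro x y a hx hy ha h
    have h0 := (mem_zeroFace.1 h).2
    rw [map_add, map_smul, smul_eq_mul] at h0
    have := mul_nonneg ha.le (hm x hx)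
    have h1 : a * evalR m x = 0 := by linarith [hm y hy]
    exact mem_zeroFace.2 ⟨hx, (mul_eq_zero.1 h1).resolve_left ha.ne'⟩

/-- A rational cone has a point that lies on no proper face. -/
theorem IsRationalPolyhedral.exists_interior_point {κ : PointedCone ℝ (RealSpan Q)}
    (hκ : IsRationalPolyhedral κ) :
    ∃ y ∈ κ, ∀ ρ : PointedCone ℝ (RealSpan Q), ρ.IsFaceOf κ → y ∈ ρ → ρ = κ := by
  classical
  obtain ⟨s, rfl⟩ := hκ
  have hs : ∀ n ∈ s, (1 : ℝ) ⊗ₜ[ℤ] n ∈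
      PointedCone.hull ℝ ((fun n : Q => (1 : ℝ) ⊗ₜ[ℤ] n) '' (s : Set Q)) :=
    fun n hn => Submodule.subset_span ⟨n, hn, rfl⟩
  -- A face that contains the sum of the generators contains each generator.
  refine ⟨∑ n ∈ s, (1 : ℝ) ⊗ₜ[ℤ] n, Submodule.sum_mem _ hs, fun ρ hρ hy => ?_⟩
  refine le_antisymm hρ.le (Submodule.span_le.2 ?_)
  rintro _ ⟨n, hn, rfl⟩
  rw [← Finset.add_sum_erase s (fun n => (1 : ℝ) ⊗ₜ[ℤ] n) hn] at hy
  exact hρ.mem_of_add_mem_left (hs n hn)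
    (Submodule.sum_mem _ fun k hk => hs k (Finset.mem_of_mem_erase hk)) hy

/-- For a weakly semistable morphism, a functional on `N` which is nonnegative on the fibre of `σ`
over `0` differs by a functional on `Q` from one which is nonnegative on `σ` and vanishes somewhere
on each fibre of `σ` over its image. -/
theorem Fan.Hom.IsWeaklySemistable.exists_normalized [Module.Free ℤ N] [Module.Finite ℤ N]
    [Module.Free ℤ Q] [Module.Finite ℤ Q] {F : Fan N} {G : Fan Q} {p : F.Hom G}
    (hp : p.IsWeaklySemistable) {σ : PointedCone ℝ (RealSpan N)} (hσ : σ ∈ F.cones)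
    (a : Module.Dual ℤ N) (ha : ∀ x ∈ σ, realMap p.toLinearMap x = 0 → 0 ≤ evalR a x) :
    ∃ (b : Module.Dual ℤ N) (u : Module.Dual ℤ Q), a = b + u ∘ₗ p.toLinearMap ∧ b ∈ dualMonoid σ ∧
      ∀ x ∈ σ, ∃ x' ∈ σ, realMap p.toLinearMap x' = realMap p.toLinearMap x ∧ evalR b x' = 0 := by
  have hκ := hp.map_cone_mem σ hσ
  obtain ⟨y, hy, hyκ⟩ := (G.isRationalPolyhedral _ hκ).exists_interior_point
  obtain ⟨x₁, hx₁, rfl⟩ := PointedCone.mem_map.1 hy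
  obtain ⟨m, c, hc, hm, x₀, hx₀, e, hz⟩ :=
    exists_certificate (F.isRationalPolyhedral σ hσ) p.toLinearMap a ha hx₁
  have hτF : zeroFace σ (c • a + m ∘ₗ p.toLinearMap) ∈ F.cones :=
    F.face_mem σ hσ _ (isFaceOf_zeroFace hm)
  have hτG := hp.map_cone_mem _ hτF
  have hle : (zeroFace σ (c • a + m ∘ₗ p.toLinearMap)).map (realMap p.toLinearMap) ≤
      σ.map (realMap p.toLinearMap) := Submodule.map_mono inf_le_left
  have hface := G.inf_isFaceOf _ hκ _ hτG
  rw [inf_eq_right.2 hle] at hface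
  -- The image of the zero face is a face of `p(σ)` through an interior point, so it is all of
  -- `p(σ)`.
  have hτκ := hyκ _ hface (PointedCone.mem_map.2 ⟨x₀, mem_zeroFace.2 ⟨hx₀, hz⟩, e⟩)
  have hlat := hp.map_latticePoints _ hτF _ hκ hτκ
  -- Condition (2), applied to the zero face, lifts `y` to a lattice point `n` with `c * a n + m y =
  -- 0`.
  have hdvd : ∀ y ∈ latticePoints (σ.map (realMap p.toLinearMap)), c ∣ (-m) y := by
    intro y hy
    rw [← hlat] at hy
    obtain ⟨n, hn, rfl⟩ := hy
    have h0 := (mem_zeroFace.1 hn).2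
    rw [evalR_tmul, mul_one] at h0
    have h1 : c * a n + m (p.toLinearMap n) = 0 := by
      have : (c • a + m ∘ₗ p.toLinearMap) n = 0 := by exact_mod_cast h0
      simpa using this
    exact ⟨a n, by
      change -(m (p.toLinearMap n)) = _
      linarith⟩
  obtain ⟨u, hu⟩ := exists_eq_smul_on_latticePoints (-m) c hdvd
  have hu0 : ∀ x ∈ σ, evalR (c • u + m) (realMap p.toLinearMap x) = 0 := by
    intro x hx
    have hx' : realMap p.toLinearMap x ∈ σ.map (realMap p.toLinearMap) :=
      PointedCone.mem_map.2 ⟨x, hx, rfl⟩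
    have hval : ∀ n ∈ latticePoints (σ.map (realMap p.toLinearMap)), (c • u + m) n = 0 := by
      intro n hn
      have := hu n hn
      simp only [LinearMap.neg_apply, LinearMap.add_apply, LinearMap.smul_apply,
        smul_eq_mul] at this ⊢
      linarith
    have h1 := (G.isRationalPolyhedral _ hκ).evalR_nonneg (m := c • u + m)
      (fun n hn => (hval n hn).ge) _ hx'
    have h2 := (G.isRationalPolyhedral _ hκ).evalR_nonneg (m := 0 - (c • u + m))
      (fun n hn => by rw [LinearMap.sub_apply, hval n hn]; simp) _ hx'
    rw [evalR_sub, evalR_zero] at h2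
    linarith
  have hc' : (0 : ℝ) < c := by exact_mod_cast hc
  -- As `c • u = -m` on `p(σ)`, the integral functional `a - u ∘ p` is the certificate divided by
  -- `c`, with the same sign and the same zero face on `σ`.
  have hb : ∀ x ∈ σ, c * evalR (a - u ∘ₗ p.toLinearMap) x =
      evalR (c • a + m ∘ₗ p.toLinearMap) x := by
    intro x hx
    have := hu0 x hx
    rw [evalR_add, evalR_smul] at this
    rw [evalR_sub, evalR_add, evalR_smul, evalR_comp, evalR_comp]
    linarith
  refine ⟨a - u ∘ₗ p.toLinearMap, u, by abel, fun x hx => ?_, fun x hx => ?_⟩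
  · exact nonneg_of_mul_nonneg_right ((hb x hx).symm ▸ hm x hx) hc'
  · have hx' : realMap p.toLinearMap x ∈ σ.map (realMap p.toLinearMap) :=
      PointedCone.mem_map.2 ⟨x, hx, rfl⟩
    rw [← hτκ] at hx'
    obtain ⟨x', hx', e'⟩ := PointedCone.mem_map.1 hx'
    obtain ⟨h1, h2⟩ := mem_zeroFace.1 hx'
    refine ⟨x', h1, e', ?_⟩
    rw [← hb x' h1] at h2
    exact (mul_eq_zero.1 h2).resolve_left hc'.ne'

end LatticeCones

/-! ### Dual monoids and coordinate rings of fiber cones; weak semistability of the projection. -/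

section FiberProductRings

variable {N Q L : Type u} [AddCommGroup N] [AddCommGroup Q] [AddCommGroup L]

/-- A section `s` of `p` yields the retraction `(n, l) ↦ (n + s (q l - p n), l)` of `N × L` onto the
fiber lattice, so every functional extends to `N × L`. -/
theorem exists_dual_fiberLattice (p : N →ₗ[ℤ] Q) (q : L →ₗ[ℤ] Q) {s : Q →ₗ[ℤ] N}
    (hs : p ∘ₗ s = LinearMap.id) (w : Module.Dual ℤ (fiberLattice p q)) :
    ∃ (a : Module.Dual ℤ N) (b : Module.Dual ℤ L),
      w = a ∘ₗ fiberFst p q + b ∘ₗ fiberSnd p q := by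
  have hs' : ∀ y, p (s y) = y := LinearMap.congr_fun hs
  let r : N × L →ₗ[ℤ] N × L :=
    LinearMap.id + LinearMap.inl ℤ N L ∘ₗ s ∘ₗ
      (q ∘ₗ LinearMap.snd ℤ N L - p ∘ₗ LinearMap.fst ℤ N L)
  have hr : ∀ z, r z ∈ fiberLattice p q := fun z => by
    simp [r, LinearMap.mem_eqLocus, hs']
  let r' := r.codRestrict (fiberLattice p q) hr
  refine ⟨w ∘ₗ r' ∘ₗ LinearMap.inl ℤ N L, w ∘ₗ r' ∘ₗ LinearMap.inr ℤ N L, ?_⟩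
  refine LinearMap.ext fun z => ?_
  have hz : p z.1.1 = q z.1.2 := z.2
  simp only [LinearMap.add_apply, LinearMap.comp_apply, ← map_add]
  refine congrArg w (Subtype.ext ?_)
  simp [r', r, hz]

/-- The difference of the two pairs kills the kernel of `p ∘ fst - q ∘ snd`, so it factors through
`Q`. Testing on `(n - s (p n), 0)` and `(s (q l), l)` identifies the factor as `(a' - a) ∘ s`. -/
theorem exists_dual_of_fiberLattice_eq (p : N →ₗ[ℤ] Q) (q : L →ₗ[ℤ] Q) {s : Q →ₗ[ℤ] N}
    (hs : p ∘ₗ s = LinearMap.id) {a a' : Module.Dual ℤ N} {b b' : Module.Dual ℤ L}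
    (h : a ∘ₗ fiberFst p q + b ∘ₗ fiberSnd p q = a' ∘ₗ fiberFst p q + b' ∘ₗ fiberSnd p q) :
    ∃ u : Module.Dual ℤ Q, a' = a + u ∘ₗ p ∧ b = b' + u ∘ₗ q := by
  have hs' : ∀ y, p (s y) = y := LinearMap.congr_fun hs
  have h' : ∀ n l, p n = q l → a n + b l = a' n + b' l := fun n l e =>
    LinearMap.congr_fun h ⟨(n, l), e⟩
  refine ⟨(a' - a) ∘ₗ s, LinearMap.ext fun n => ?_, LinearMap.ext fun l => ?_⟩
  · have := h' (n - s (p n)) 0 (by simp [hs'])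
    simp only [map_sub, map_zero] at this
    simp only [LinearMap.add_apply, LinearMap.comp_apply, LinearMap.sub_apply]
    linarith
  · have := h' (s (q l)) l (by simp [hs'])
    simp only [LinearMap.add_apply, LinearMap.comp_apply, LinearMap.sub_apply]
    linarith

theorem isFaceOf_inf_comap {q : L →ₗ[ℤ] Q} {τ : PointedCone ℝ (RealSpan L)}
    {ρ κ : PointedCone ℝ (RealSpan Q)} (h : ρ.IsFaceOf κ) (hq : ∀ z ∈ τ, realMap q z ∈ κ) :
    (τ ⊓ ρ.comap (realMap q)).IsFaceOf τ where
  le := inf_le_left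
  mem_of_smul_add_mem := by
    intro x y a hx hy ha hxy
    have h0 : realMap q (a • x + y) ∈ ρ := (Submodule.mem_inf.1 hxy).2
    rw [map_add, map_smul] at h0
    exact Submodule.mem_inf.2 ⟨hx, h.mem_of_smul_add_mem (hq x hx) (hq y hy) ha h0⟩

theorem map_fiberSnd_fiberCone (p : N →ₗ[ℤ] Q) (q : L →ₗ[ℤ] Q) (σ : PointedCone ℝ (RealSpan N))
    (τ : PointedCone ℝ (RealSpan L)) :
    (fiberCone p q σ τ).map (realMap (fiberSnd p q)) =
      τ ⊓ (σ.map (realMap p)).comap (realMap q) := by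
  have hpq : p ∘ₗ fiberFst p q = q ∘ₗ fiberSnd p q := LinearMap.ext fun y => y.2
  refine le_antisymm (fun z hz => ?_) fun z hz => ?_
  · obtain ⟨y, hy, rfl⟩ := PointedCone.mem_map.1 hz
    obtain ⟨h1, h2⟩ := mem_fiberCone.1 hy
    refine Submodule.mem_inf.2 ⟨h2, PointedCone.mem_comap.2 (PointedCone.mem_map.2 ⟨_, h1, ?_⟩)⟩
    rw [realMap_realMap, realMap_realMap, hpq]
  · obtain ⟨h1, h2⟩ := Submodule.mem_inf.1 hz
    obtain ⟨x, hx, e⟩ := PointedCone.mem_map.1 (PointedCone.mem_comap.1 h2)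
    obtain ⟨w, rfl, rfl⟩ := exists_realSpan_fiberLattice p q e
    exact PointedCone.mem_map.2 ⟨w, mem_fiberCone.2 ⟨hx, h1⟩, rfl⟩

variable [Module.Free ℤ N] [Module.Finite ℤ N]
variable {F : Fan N} {G : Fan Q} {p : F.Hom G}

section WeakSemistability

variable [Module.Free ℤ L] [Module.Finite ℤ L] {H : Fan L}

/-- Being a cone of `G` inside `κ`, `p(σ)` is a face of `κ`; hence the image `τ ∩ q⁻¹(p(σ))` is a
face of `τ`. A lattice point `l` of it lifts to `(n, l)`, where condition (2) for `p` supplies `n`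
in `σ` over `q(l)`. -/
theorem Fan.Hom.IsWeaklySemistable.fiberProductSnd (hp : p.IsWeaklySemistable) (q : H.Hom G) :
    (Fan.fiberProductSnd p q).IsWeaklySemistable where
  map_cone_mem := by
    rintro _ ⟨σ, hσ, τ, hτ, κ, hκ, h1, h2, rfl⟩
    change (fiberCone p.toLinearMap q.toLinearMap σ τ).map (realMap (fiberSnd _ _)) ∈ _
    rw [map_fiberSnd_fiberCone]
    refine H.face_mem τ hτ _ (isFaceOf_inf_comap (κ := κ) ?_ h2)
    have hle : σ.map (realMap p.toLinearMap) ≤ κ := by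
      rintro _ ⟨x, hx, rfl⟩
      exact h1 x hx
    have := G.inf_isFaceOf κ hκ _ (hp.map_cone_mem σ hσ)
    rwa [inf_eq_right.2 hle] at this
  map_latticePoints := by
    rintro _ ⟨σ, hσ, τ, hτ, κ, hκ, h1, h2, rfl⟩ _ _ rfl
    change _ = latticePoints
      ((fiberCone p.toLinearMap q.toLinearMap σ τ).map (realMap (fiberSnd _ _)))
    refine le_antisymm ?_ fun l hl => ?_
    · rintro _ ⟨y, hy, rfl⟩
      exact PointedCone.mem_map.2 ⟨_, hy, by simp; rfl⟩
    · rw [mem_latticePoints, map_fiberSnd_fiberCone] at hl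
      obtain ⟨hl1, hl2⟩ := Submodule.mem_inf.1 hl
      have hl3 : q.toLinearMap l ∈ latticePoints (σ.map (realMap p.toLinearMap)) := by
        simpa [mem_latticePoints] using hl2
      rw [← hp.map_latticePoints σ hσ _ (hp.map_cone_mem σ hσ) rfl] at hl3
      obtain ⟨n, hn, e⟩ := hl3
      refine ⟨⟨(n, l), e⟩, mem_fiberCone.2 ⟨?_, ?_⟩, rfl⟩
      · simpa using mem_latticePoints.1 hn
      · simpa using hl1

end WeakSemistability

variable [Module.Free ℤ Q] [Module.Finite ℤ Q]
variable {q : L →ₗ[ℤ] Q} {σ : PointedCone ℝ (RealSpan N)} {τ : PointedCone ℝ (RealSpan L)}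

/-- Start from any decomposition `(a₀, b₀)` and move the part `u` of the normal form of `a₀` over to
the other side. Over each `q(z)` the normalized functional vanishes at some point of `σ`, and
nonnegativity of `w` there is exactly nonnegativity of `b₀ + u ∘ q` at `z`. -/
theorem exists_add_of_mem_dualMonoid_fiberCone (hp : p.IsWeaklySemistable)
    {s : Q →ₗ[ℤ] N} (hs : p.toLinearMap ∘ₗ s = LinearMap.id) (hσ : σ ∈ F.cones)
    (hq : ∀ z ∈ τ, realMap q z ∈ σ.map (realMap p.toLinearMap))
    {w : Module.Dual ℤ (fiberLattice p.toLinearMap q)}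
    (hw : w ∈ dualMonoid (fiberCone p.toLinearMap q σ τ)) :
    ∃ a ∈ dualMonoid σ, ∃ b ∈ dualMonoid τ,
      w = a ∘ₗ fiberFst p.toLinearMap q + b ∘ₗ fiberSnd p.toLinearMap q := by
  obtain ⟨a₀, b₀, rfl⟩ := exists_dual_fiberLattice p.toLinearMap q hs w
  have hw' : ∀ x ∈ σ, ∀ z ∈ τ, realMap p.toLinearMap x = realMap q z →
      0 ≤ evalR a₀ x + evalR b₀ z := by
    intro x hx z hz e
    obtain ⟨y, rfl, rfl⟩ := exists_realSpan_fiberLattice p.toLinearMap q e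
    have := hw y (mem_fiberCone.2 ⟨hx, hz⟩)
    rwa [evalR_add, evalR_comp, evalR_comp] at this
  obtain ⟨a, u, rfl, ha, ha'⟩ := hp.exists_normalized hσ a₀ fun x hx h0 => by
    simpa using hw' x hx 0 τ.zero_mem (by rw [h0, map_zero])
  refine ⟨a, ha, b₀ + u ∘ₗ q, fun z hz => ?_, LinearMap.ext fun y => ?_⟩
  · obtain ⟨x, hx, e⟩ := PointedCone.mem_map.1 (hq z hz)
    obtain ⟨x', hx', e', h0⟩ := ha' x hx
    have := hw' x' hx' z hz (e'.trans e)
    rw [evalR_add, evalR_comp, h0, e', e] at this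
    rw [evalR_add, evalR_comp]
    linarith
  · have : p.toLinearMap y.1.1 = q y.1.2 := y.2
    simp only [LinearMap.add_apply, LinearMap.comp_apply, LinearMap.fst_apply,
      LinearMap.snd_apply, Submodule.subtype_apply, this]
    ring

/-- A pair of compatible monoid homomorphisms on `σ^∨` and `τ^∨` is well defined on the sum of their
images in the dual of the fiber lattice. -/
theorem mul_eq_mul_of_fiberLattice_eq {B : Type*} [CommMonoid B] (hp : p.IsWeaklySemistable)
    {s : Q →ₗ[ℤ] N} (hs : p.toLinearMap ∘ₗ s = LinearMap.id) (hσ : σ ∈ F.cones)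
    {κ : PointedCone ℝ (RealSpan Q)} (hκ : σ.map (realMap p.toLinearMap) = κ)
    (h : ∀ x ∈ σ, realMap p.toLinearMap x ∈ κ) (hq : ∀ z ∈ τ, realMap q z ∈ κ)
    (f : Multiplicative (dualMonoid σ) →* B) (g : Multiplicative (dualMonoid τ) →* B)
    (hfg : ∀ r : dualMonoid κ, f (.ofAdd (dualMonoidMap p.toLinearMap h r)) =
      g (.ofAdd (dualMonoidMap q hq r)))
    (a a' : dualMonoid σ) (b b' : dualMonoid τ)
    (e : a.1 ∘ₗ fiberFst p.toLinearMap q + b.1 ∘ₗ fiberSnd p.toLinearMap q =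
      a'.1 ∘ₗ fiberFst p.toLinearMap q + b'.1 ∘ₗ fiberSnd p.toLinearMap q) :
    f (.ofAdd a) * g (.ofAdd b) = f (.ofAdd a') * g (.ofAdd b') := by
  obtain ⟨u, hu, hu'⟩ := exists_dual_of_fiberLattice_eq p.toLinearMap q hs e
  -- The functionals `a` and `a'` differ by a pullback from `Q`, so they share the normal form `c`.
  -- Since `c` vanishes somewhere on each fibre, both corrections `r` and `r + u` lie in `κ^∨` and
  -- can be moved across by `hfg`, with no cancellation in `B`.
  obtain ⟨c, r, hr, hc, hc'⟩ := hp.exists_normalized hσ a.1 fun x hx _ => a.2 x hx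
  have hmem : ∀ v : Module.Dual ℤ Q, c + v ∘ₗ p.toLinearMap ∈ dualMonoid σ →
      v ∈ dualMonoid κ := by
    intro v hv y hy
    rw [← hκ] at hy
    obtain ⟨x, hx, rfl⟩ := PointedCone.mem_map.1 hy
    obtain ⟨x', hx', e', h0⟩ := hc' x hx
    have := hv x' hx'
    rwa [evalR_add, evalR_comp, h0, zero_add, e'] at this
  have hr₁ : r ∈ dualMonoid κ := hmem r (hr ▸ a.2)
  have ea' : a'.1 = c + (r + u) ∘ₗ p.toLinearMap := by
    rw [hu, hr, LinearMap.add_comp, add_assoc]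
  have hr₂ : r + u ∈ dualMonoid κ := hmem _ (ea' ▸ a'.2)
  have e₁ : a = ⟨c, hc⟩ + dualMonoidMap p.toLinearMap h ⟨r, hr₁⟩ := Subtype.ext hr
  have e₂ : a' = ⟨c, hc⟩ + dualMonoidMap p.toLinearMap h ⟨r + u, hr₂⟩ := Subtype.ext ea'
  have e₃ : dualMonoidMap q hq ⟨r, hr₁⟩ + b = dualMonoidMap q hq ⟨r + u, hr₂⟩ + b' :=
    Subtype.ext (by
      change r ∘ₗ q + b.1 = (r + u) ∘ₗ q + b'.1
      rw [hu', LinearMap.add_comp]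
      abel)
  rw [e₁, e₂, ofAdd_add, ofAdd_add, map_mul, map_mul, hfg, hfg, mul_assoc, mul_assoc,
    ← map_mul g, ← map_mul g, ← ofAdd_add, ← ofAdd_add, e₃]

/-- For a weakly semistable morphism, the chart of a toric fiber product is the pullback of the
charts: its coordinate ring is the pushout of their coordinate rings. -/
theorem isPullback_chartMap (hp : p.IsWeaklySemistable)
    (hsurj : Function.Surjective p.toLinearMap) (hσ : σ ∈ F.cones)
    {κ : PointedCone ℝ (RealSpan Q)} (hκ : σ.map (realMap p.toLinearMap) = κ)
    (h : ∀ x ∈ σ, realMap p.toLinearMap x ∈ κ) (hq : ∀ z ∈ τ, realMap q z ∈ κ)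
    (h₁ : ∀ x ∈ fiberCone p.toLinearMap q σ τ, realMap (fiberFst p.toLinearMap q) x ∈ σ)
    (h₂ : ∀ x ∈ fiberCone p.toLinearMap q σ τ, realMap (fiberSnd p.toLinearMap q) x ∈ τ) :
    IsPullback (chartMap (fiberFst p.toLinearMap q) h₁) (chartMap (fiberSnd p.toLinearMap q) h₂)
      (chartMap p.toLinearMap h) (chartMap q hq) := by
  obtain ⟨s, hs⟩ := Module.projective_lifting_property p.toLinearMap LinearMap.id hsurj
  let ip := AddMonoidAlgebra.mapDomainRingHom ℂ (dualMonoidMap p.toLinearMap h)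
  let iq := AddMonoidAlgebra.mapDomainRingHom ℂ (dualMonoidMap q hq)
  let i₁ := AddMonoidAlgebra.mapDomainRingHom ℂ (dualMonoidMap (fiberFst p.toLinearMap q) h₁)
  let i₂ := AddMonoidAlgebra.mapDomainRingHom ℂ (dualMonoidMap (fiberSnd p.toLinearMap q) h₂)
  have hsum : ∀ w : dualMonoid (fiberCone p.toLinearMap q σ τ), ∃ (a : dualMonoid σ)
      (b : dualMonoid τ), w = dualMonoidMap (fiberFst p.toLinearMap q) h₁ a +
        dualMonoidMap (fiberSnd p.toLinearMap q) h₂ b := by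
    rintro ⟨w, hw⟩
    obtain ⟨a, ha, b, hb, e⟩ := exists_add_of_mem_dualMonoid_fiberCone hp hs hσ
      (fun z hz => by rw [hκ]; exact hq z hz) hw
    exact ⟨⟨a, ha⟩, ⟨b, hb⟩, Subtype.ext e⟩
  have hcomm : i₁.comp ip = i₂.comp iq := by
    refine AddMonoidAlgebra.ringHom_ext (fun c => ?_) fun r => ?_
    · simp [i₁, i₂, ip, iq]
    · simp only [i₁, i₂, ip, iq, RingHom.comp_apply, AddMonoidAlgebra.mapDomainRingHom_apply,
        AddMonoidAlgebra.mapDomain_single]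
      refine congrArg (fun z => AddMonoidAlgebra.single z (1 : ℂ)) (Subtype.ext ?_)
      exact LinearMap.ext fun y => congrArg r.1 y.2
  have huniq : ∀ {B : Type u} [CommRing B] (χ χ' : AddMonoidAlgebra ℂ
      (dualMonoid (fiberCone p.toLinearMap q σ τ)) →+* B), χ.comp i₁ = χ'.comp i₁ →
      χ.comp i₂ = χ'.comp i₂ → χ = χ' := by
    intro B _ χ χ' e₁ e₂
    have e : ∀ (w) (c : ℂ), χ (AddMonoidAlgebra.single w c) =
        χ' (AddMonoidAlgebra.single w c) := by
      intro w c
      obtain ⟨a, b, rfl⟩ := hsum w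
      have h1 := RingHom.congr_fun e₁ (AddMonoidAlgebra.single a c)
      have h2 := RingHom.congr_fun e₂ (AddMonoidAlgebra.single b 1)
      simp only [i₁, i₂, RingHom.comp_apply, AddMonoidAlgebra.mapDomainRingHom_apply,
        AddMonoidAlgebra.mapDomain_single] at h1 h2
      rw [← mul_one c, ← AddMonoidAlgebra.single_mul_single, map_mul, map_mul, h1, h2]
    exact AddMonoidAlgebra.ringHom_ext (fun c => e _ c) fun w => e w 1
  have hdesc : ∀ {B : Type u} [CommRing B] (φ : AddMonoidAlgebra ℂ (dualMonoid σ) →+* B)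
      (ψ : AddMonoidAlgebra ℂ (dualMonoid τ) →+* B), φ.comp ip = ψ.comp iq →
      ∃ χ : AddMonoidAlgebra ℂ (dualMonoid (fiberCone p.toLinearMap q σ τ)) →+* B,
        χ.comp i₁ = φ ∧ χ.comp i₂ = ψ := by
    intro B _ φ ψ hφψ
    let f : Multiplicative (dualMonoid σ) →* B := φ.toMonoidHom.comp (AddMonoidAlgebra.of ℂ _)
    let g : Multiplicative (dualMonoid τ) →* B := ψ.toMonoidHom.comp (AddMonoidAlgebra.of ℂ _)
    have hf : ∀ a, f (.ofAdd a) = φ (AddMonoidAlgebra.single a 1) := fun _ => rfl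
    have hg : ∀ a, g (.ofAdd a) = ψ (AddMonoidAlgebra.single a 1) := fun _ => rfl
    have hfg : ∀ r : dualMonoid κ, f (.ofAdd (dualMonoidMap p.toLinearMap h r)) =
        g (.ofAdd (dualMonoidMap q hq r)) := fun r => by
      have := RingHom.congr_fun hφψ (AddMonoidAlgebra.single r 1)
      simpa only [ip, iq, RingHom.comp_apply, AddMonoidAlgebra.mapDomainRingHom_apply,
        AddMonoidAlgebra.mapDomain_single, hf, hg] using this
    have hwd := mul_eq_mul_of_fiberLattice_eq hp hs hσ hκ h hq f g hfg
    -- The chosen decompositions need not be additive; by `hk` the product of their values does not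
    -- depend on the choice, which makes `k` multiplicative.
    choose A C hAC using hsum
    have hk : ∀ w a b, w = dualMonoidMap (fiberFst p.toLinearMap q) h₁ a +
        dualMonoidMap (fiberSnd p.toLinearMap q) h₂ b →
        f (.ofAdd (A w)) * g (.ofAdd (C w)) = f (.ofAdd a) * g (.ofAdd b) := fun w a b e =>
      hwd _ _ _ _ (congrArg Subtype.val ((hAC w).symm.trans e))
    let k : Multiplicative (dualMonoid (fiberCone p.toLinearMap q σ τ)) →* B :=
      { toFun := fun w => f (.ofAdd (A w.toAdd)) * g (.ofAdd (C w.toAdd))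
        map_one' := by
          rw [hk _ 0 0 (by simp), ofAdd_zero, ofAdd_zero, map_one, map_one, mul_one]
        map_mul' := fun w w' => by
          rw [hk _ (A w.toAdd + A w'.toAdd) (C w.toAdd + C w'.toAdd), ofAdd_add, ofAdd_add,
            map_mul, map_mul]
          · exact mul_mul_mul_comm _ _ _ _
          · rw [map_add, map_add, toAdd_mul]
            nth_rw 1 [hAC w.toAdd, hAC w'.toAdd]
            abel }
    -- The pullback is taken among all schemes, so `φ` and `ψ` are mere ring maps; they agree on
    -- constants because `ℂ` lies in the ring of `κ`.
    have hφψ₀ : ∀ c : ℂ, φ (AddMonoidAlgebra.single 0 c) = ψ (AddMonoidAlgebra.single 0 c) :=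
      fun c => by
        have := RingHom.congr_fun hφψ (AddMonoidAlgebra.single 0 c)
        simpa only [ip, iq, RingHom.comp_apply, AddMonoidAlgebra.mapDomainRingHom_apply,
          AddMonoidAlgebra.mapDomain_single, map_zero] using this
    let χ := AddMonoidAlgebra.liftNCRingHom (φ.comp AddMonoidAlgebra.singleZeroRingHom) k
      fun _ _ => Commute.all _ _
    have hχ : ∀ w (c : ℂ), χ (AddMonoidAlgebra.single w c) =
        φ (AddMonoidAlgebra.single 0 c) * (f (.ofAdd (A w)) * g (.ofAdd (C w))) := fun w c =>
      AddMonoidAlgebra.liftNCRingHom_single _ _ _ _ _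
    have h₁' : ∀ a (c : ℂ), χ (i₁ (AddMonoidAlgebra.single a c)) =
        φ (AddMonoidAlgebra.single a c) := by
      intro a c
      rw [AddMonoidAlgebra.mapDomainRingHom_apply, AddMonoidAlgebra.mapDomain_single, hχ,
        hk _ a 0 (by simp), ofAdd_zero, map_one, mul_one, hf, ← map_mul,
        AddMonoidAlgebra.single_mul_single, zero_add, mul_one]
    have h₂' : ∀ a (c : ℂ), χ (i₂ (AddMonoidAlgebra.single a c)) =
        ψ (AddMonoidAlgebra.single a c) := by
      intro a c
      rw [AddMonoidAlgebra.mapDomainRingHom_apply, AddMonoidAlgebra.mapDomain_single, hχ,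
        hk _ 0 a (by simp), ofAdd_zero, map_one, one_mul, hg, hφψ₀, ← map_mul,
        AddMonoidAlgebra.single_mul_single, zero_add, mul_one]
    exact ⟨χ, AddMonoidAlgebra.ringHom_ext (fun c => h₁' _ c) fun a => h₁' a 1,
      AddMonoidAlgebra.ringHom_ext (fun c => h₂' _ c) fun a => h₂' a 1⟩
  have hcond : ∀ c : PushoutCocone (CommRingCat.ofHom ip) (CommRingCat.ofHom iq),
      c.inl.hom.comp ip = c.inr.hom.comp iq := fun c =>
    congrArg CommRingCat.Hom.hom c.condition
  choose χ hχ₁ hχ₂ using fun c : PushoutCocone (CommRingCat.ofHom ip) (CommRingCat.ofHom iq) =>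
    hdesc c.inl.hom c.inr.hom (hcond c)
  exact isPullback_SpecMap_of_isPushout _ _ _ _ ⟨⟨CommRingCat.hom_ext hcomm⟩,
    ⟨PushoutCocone.IsColimit.mk (CommRingCat.hom_ext hcomm) (fun c => CommRingCat.ofHom (χ c))
      (fun c => CommRingCat.hom_ext (hχ₁ c)) (fun c => CommRingCat.hom_ext (hχ₂ c))
      fun c m e₁ e₂ => CommRingCat.hom_ext <| huniq _ _
        ((congrArg CommRingCat.Hom.hom e₁).trans (hχ₁ c).symm)
        ((congrArg CommRingCat.Hom.hom e₂).trans (hχ₂ c).symm)⟩⟩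

end FiberProductRings

/-! ### Points of a toric variety and the charts that contain them. -/

section Realization

variable {N Q : Type u} [AddCommGroup N] [AddCommGroup Q]
variable [Module.Free ℤ Q] [Module.Finite ℤ Q]

/-- If a point of a chart is taken into the chart of a face `ρ` of `κ`, then it lies in the chart of
the face of `σ` which is taken into `ρ`. -/
theorem mem_range_chartIncl_of_chartMap {p : N →ₗ[ℤ] Q} {σ τ : PointedCone ℝ (RealSpan N)}
    {κ ρ : PointedCone ℝ (RealSpan Q)} (hσ : IsRationalPolyhedral σ) (hκ : IsRationalPolyhedral κ)
    (h : ∀ x ∈ σ, realMap p x ∈ κ) (hρ : ρ.IsFaceOf κ) (hτσ : τ ≤ σ)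
    (hτ : τ = σ ⊓ ρ.comap (realMap p)) {x : chart σ}
    (hx : chartMap p h x ∈ Set.range (chartIncl hρ.le)) : x ∈ Set.range (chartIncl hτσ) := by
  -- The chart of `ρ` is the locus where the character `m` is invertible. Its preimage is the locus
  -- where `m ∘ p` is invertible, which is the chart of the face of `σ` cut out by `m ∘ p`.
  obtain ⟨m, hm, hmρ⟩ := exists_functional_of_isFaceOf hκ hρ
  rw [range_chartIncl hκ hρ.le hm hmρ] at hx
  have hm' : m ∘ₗ p ∈ dualMonoid σ := (dualMonoidMap p h ⟨m, hm⟩).2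
  have hmτ : ∀ y ∈ σ, y ∈ τ ↔ evalR (m ∘ₗ p) y = 0 := by
    intro y hy
    rw [evalR_comp, ← hmρ _ (h y hy), hτ]
    exact ⟨fun h => (Submodule.mem_inf.1 h).2, fun h => Submodule.mem_inf.2 ⟨hy, h⟩⟩
  rw [range_chartIncl hσ hτσ hm' hmτ]
  have e : AddMonoidAlgebra.mapDomainRingHom ℂ (dualMonoidMap p h)
      (AddMonoidAlgebra.single (⟨m, hm⟩ : dualMonoid κ) 1) =
      AddMonoidAlgebra.single (⟨m ∘ₗ p, hm'⟩ : dualMonoid σ) 1 := by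
    rw [AddMonoidAlgebra.mapDomainRingHom_apply, AddMonoidAlgebra.mapDomain_single]; rfl
  rw [← e]
  exact hx

variable [Module.Free ℤ N] [Module.Finite ℤ N]
variable {F : Fan N} {G : Fan Q}

namespace Fan

instance (F : Fan N) (σ : F.cones) : IsOpenImmersion (F.ι σ) :=
  inferInstanceAs (IsOpenImmersion (colimit.ι F.chartDiagram σ))

theorem exists_ι_eq (F : Fan N) (x : F.realization) :
    ∃ (σ : F.cones) (y : chart σ.1), F.ι σ y = x :=
  Scheme.IsLocallyDirected.ι_jointly_surjective F.chartDiagram x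

/-- The intersection of two cones of a fan. -/
def inter (F : Fan N) (σ τ : F.cones) : F.cones :=
  ⟨σ.1 ⊓ τ.1, F.face_mem _ σ.2 _ (F.inf_isFaceOf _ σ.2 _ τ.2)⟩

theorem realization_hom_ext (F : Fan N) {X : Scheme.{u}} {f g : F.realization ⟶ X}
    (h : ∀ σ, F.ι σ ≫ f = F.ι σ ≫ g) : f = g :=
  colimit.hom_ext h

theorem ι_chartIncl_apply (F : Fan N) {τ σ : F.cones} (h : τ.1 ≤ σ.1) (x : chart τ.1) :
    F.ι σ (chartIncl h x) = F.ι τ x := by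
  rw [← F.chartIncl_ι h, Scheme.Hom.comp_apply]

theorem range_ι_mono (F : Fan N) {σ τ : F.cones} (h : τ.1 ≤ σ.1) :
    Set.range (F.ι τ) ⊆ Set.range (F.ι σ) := by
  rintro _ ⟨x, rfl⟩
  exact ⟨chartIncl h x, F.ι_chartIncl_apply h x⟩

/-- Two points of charts are glued only through a chart of a cone contained in both, because the
diagram is locally directed. -/
theorem mem_range_ι_inter (F : Fan N) {σ τ : F.cones} {x : F.realization}
    (h₁ : x ∈ Set.range (F.ι σ)) (h₂ : x ∈ Set.range (F.ι τ)) :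
    x ∈ Set.range (F.ι (F.inter σ τ)) := by
  obtain ⟨y, rfl⟩ := h₁
  obtain ⟨z, hz⟩ := h₂
  obtain ⟨ρ, f, g, w, hw, -⟩ :=
    (Scheme.IsLocallyDirected.ι_eq_ι_iff F.chartDiagram).1 (show F.ι σ y = F.ι τ z from hz.symm)
  have hρ : ρ.1 ≤ (F.inter σ τ).1 := le_inf (leOfHom f) (leOfHom g)
  refine F.range_ι_mono hρ ⟨w, ?_⟩
  rw [← hw]
  exact (F.ι_chartIncl_apply (leOfHom f) w).symm

/-- Every point of a toric variety lies in a smallest affine chart. -/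
theorem exists_least_cone (F : Fan N) (x : F.realization) :
    ∃ σ : F.cones, x ∈ Set.range (F.ι σ) ∧
      ∀ τ : F.cones, x ∈ Set.range (F.ι τ) → σ.1 ≤ τ.1 := by
  have : Finite F.cones := F.finite_cones
  obtain ⟨σ₀, y, hy⟩ := F.exists_ι_eq x
  -- The cones whose charts contain `x` are closed under intersection, so a minimal one is least.
  obtain ⟨σ, hσ, hmin⟩ := (Set.toFinite {σ : F.cones | x ∈ Set.range (F.ι σ)}).exists_minimal
    ⟨σ₀, y, hy⟩
  refine ⟨σ, hσ, fun τ hτ => ?_⟩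
  have h : σ.1 ≤ (F.inter σ τ).1 :=
    hmin (F.mem_range_ι_inter hσ hτ) (inf_le_left : σ.1 ⊓ τ.1 ≤ σ.1)
  exact h.trans inf_le_right

end Fan

namespace Fan.Hom

theorem realization_mem_range_ι (p : F.Hom G) {σ : F.cones} {κ : G.cones}
    (h : ∀ x ∈ σ.1, realMap p.toLinearMap x ∈ κ.1) {x : F.realization}
    (hx : x ∈ Set.range (F.ι σ)) : p.realization x ∈ Set.range (G.ι κ) := by
  obtain ⟨y, rfl⟩ := hx
  rw [← Scheme.Hom.comp_apply, p.ι_realization σ κ h, Scheme.Hom.comp_apply]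
  exact ⟨_, rfl⟩

/-- The smallest cone of a point `x` is taken into every cone whose chart contains the image of
`x`. -/
theorem map_mem_of_realization_mem (p : F.Hom G) {x : F.realization} {σ : F.cones}
    (hx : x ∈ Set.range (F.ι σ)) (hmin : ∀ τ : F.cones, x ∈ Set.range (F.ι τ) → σ.1 ≤ τ.1)
    {κ : G.cones} (hκ : p.realization x ∈ Set.range (G.ι κ)) :
    ∀ y ∈ σ.1, realMap p.toLinearMap y ∈ κ.1 := by
  obtain ⟨y, rfl⟩ := hx
  let κ₀ := p.targetCone σ
  have h₀ := p.map_mem_targetCone σ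
  have hf : (G.inter κ₀ κ).1.IsFaceOf κ₀.1 := G.inf_isFaceOf _ κ₀.2 _ κ.2
  have hc := isFaceOf_inf_comap (q := p.toLinearMap) hf h₀
  let τ : F.cones := ⟨_, F.face_mem _ σ.2 _ hc⟩
  have e : p.realization (F.ι σ y) = G.ι κ₀ (chartMap p.toLinearMap h₀ y) := by
    rw [← Scheme.Hom.comp_apply, ← Scheme.Hom.comp_apply, p.ι_realization σ κ₀ h₀]
  obtain ⟨z, hz⟩ := G.mem_range_ι_inter ⟨_, e.symm⟩ hκ
  -- The image lies in the chart of the face `κ₀ ∩ κ` of `κ₀`, so the point lies in the chart of `σ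
  -- ∩ p⁻¹(κ₀ ∩ κ)`. Minimality of `σ` then forces this face to be `σ`.
  have hy : y ∈ Set.range (chartIncl hc.le) := by
    refine mem_range_chartIncl_of_chartMap (F.isRationalPolyhedral _ σ.2)
      (G.isRationalPolyhedral _ κ₀.2) h₀ hf hc.le rfl ⟨z, ?_⟩
    apply (G.ι κ₀).isOpenEmbedding.injective
    rw [← e, ← hz]
    exact G.ι_chartIncl_apply (τ := G.inter κ₀ κ) hf.le z
  obtain ⟨w, hw⟩ := hy
  have hτ : σ.1 ≤ τ.1 := hmin τ ⟨w, by
    rw [← hw]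
    exact (F.ι_chartIncl_apply (τ := τ) hc.le w).symm⟩
  exact fun v hv => (Submodule.mem_inf.1 (Submodule.mem_inf.1 (hτ hv)).2).2

end Fan.Hom

end Realization

/-! ### Gluing the charts: the comparison map to the pullback is an isomorphism. -/

section Cartesian

variable {N Q L : Type u} [AddCommGroup N] [AddCommGroup Q] [AddCommGroup L]
variable [Module.Free ℤ N] [Module.Finite ℤ N] [Module.Free ℤ L] [Module.Finite ℤ L]
variable {F : Fan N} {G : Fan Q} {H : Fan L}

/-- The least cone of `x` is taken by the projections into `σ` and `τ`, hence lies in the fiber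
cone. This shows that the charts are full preimages. -/
theorem mem_range_ι_fiberCone (p : F.Hom G) (q : H.Hom G) {σ : F.cones} {τ : H.cones}
    {C : (Fan.fiberProduct p q).cones}
    (hC : C.1 = fiberCone p.toLinearMap q.toLinearMap σ.1 τ.1)
    {x : (Fan.fiberProduct p q).realization}
    (h₁ : (Fan.fiberProductFst p q).realization x ∈ Set.range (F.ι σ))
    (h₂ : (Fan.fiberProductSnd p q).realization x ∈ Set.range (H.ι τ)) :
    x ∈ Set.range ((Fan.fiberProduct p q).ι C) := by
  obtain ⟨D, hD, hmin⟩ := (Fan.fiberProduct p q).exists_least_cone x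
  have e₁ := (Fan.fiberProductFst p q).map_mem_of_realization_mem hD hmin h₁
  have e₂ := (Fan.fiberProductSnd p q).map_mem_of_realization_mem hD hmin h₂
  refine Fan.range_ι_mono _ ?_ hD
  rw [hC]
  exact fun y hy => mem_fiberCone.2 ⟨e₁ y hy, e₂ y hy⟩

variable [Module.Free ℤ Q] [Module.Finite ℤ Q]

theorem fiberProduct_realization_comm (p : F.Hom G) (q : H.Hom G) :
    (Fan.fiberProductFst p q).realization ≫ p.realization =
      (Fan.fiberProductSnd p q).realization ≫ q.realization := by
  refine Fan.realization_hom_ext _ fun C => ?_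
  obtain ⟨_, σ, hσ, τ, hτ, κ, hκ, h1, h2, rfl⟩ := C
  have h : p.toLinearMap ∘ₗ fiberFst p.toLinearMap q.toLinearMap =
    q.toLinearMap ∘ₗ fiberSnd p.toLinearMap q.toLinearMap := LinearMap.ext fun y => y.2
  rw [← Category.assoc, ← Category.assoc,
    (Fan.fiberProductFst p q).ι_realization _ ⟨σ, hσ⟩ fun x hx => (mem_fiberCone.1 hx).1,
    (Fan.fiberProductSnd p q).ι_realization _ ⟨τ, hτ⟩ fun x hx => (mem_fiberCone.1 hx).2,
    Category.assoc, Category.assoc, p.ι_realization ⟨σ, hσ⟩ ⟨κ, hκ⟩ h1,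
    q.ι_realization ⟨τ, hτ⟩ ⟨κ, hκ⟩ h2, ← Category.assoc, ← Category.assoc]
  congr 1
  exact (chartMap_comp _ h1 rfl fun x hx => by
      rw [← realMap_realMap]; exact h1 _ (mem_fiberCone.1 hx).1).trans
    (chartMap_comp _ h2 h.symm _).symm

/-- A morphism `f` is an isomorphism if there are open subschemes of the source which `f` takes
isomorphically onto open subschemes covering the target, and which are the full preimages of these. -/
theorem isIso_of_isOpenImmersion_comp {X Y : Scheme.{u}} (f : X ⟶ Y) {J : Type u}
    {V : J → Scheme.{u}} (i : ∀ j, V j ⟶ X) [∀ j, IsOpenImmersion (i j)]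
    (hi : ∀ j, IsOpenImmersion (i j ≫ f)) (hcover : ∀ y, ∃ j, y ∈ Set.range (i j ≫ f))
    (hrange : ∀ j x, f x ∈ Set.range (i j ≫ f) → x ∈ Set.range (i j)) : IsIso f := by
  let 𝒰 : Y.OpenCover := Scheme.Cover.mkOfCovers J V (fun j => i j ≫ f) hcover hi
  refine IsZariskiLocalAtTarget.of_openCover (P := MorphismProperty.isomorphisms Scheme) 𝒰
    fun (j : J) => ?_
  -- Since `V j` is the full preimage of its image, the base change of `f` to `V j` is the identity.
  have hpb : IsPullback (𝟙 (V j)) (i j) (i j ≫ f) f := by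
    refine IsOpenImmersion.isPullback _ _ _ _ (Category.id_comp _).symm ?_
    ext x
    refine ⟨fun h => hrange j x h, ?_⟩
    rintro ⟨y, rfl⟩
    exact ⟨y, Scheme.Hom.comp_apply _ _ _⟩
  have h : 𝒰.pullbackHom f j = hpb.flip.isoPullback.inv ≫ 𝟙 (V j) :=
    hpb.flip.isoPullback_inv_snd.symm
  rw [MorphismProperty.isomorphisms.iff, h]
  exact IsIso.comp_isIso (f := hpb.flip.isoPullback.inv) (h := 𝟙 (V j))

/-- The pullback of open subschemes is an open subscheme of the pullback. -/
theorem isOpenImmersion_of_isPullback {X Y S X' Y' S' V P : Scheme.{u}} {a : X ⟶ S} {b : Y ⟶ S}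
    {a' : X' ⟶ S'} {b' : Y' ⟶ S'} {i₁ : X' ⟶ X} {i₂ : Y' ⟶ Y} {i₃ : S' ⟶ S}
    [IsOpenImmersion i₁] [IsOpenImmersion i₂] [IsOpenImmersion i₃] (e₁ : a' ≫ i₃ = i₁ ≫ a)
    (e₂ : b' ≫ i₃ = i₂ ≫ b) {u : V ⟶ X'} {v : V ⟶ Y'} (h : IsPullback u v a' b')
    {r : P ⟶ X} {s : P ⟶ Y} (hP : IsPullback r s a b) {k : V ⟶ P}
    (hk₁ : k ≫ r = u ≫ i₁) (hk₂ : k ≫ s = v ≫ i₂) :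
    IsOpenImmersion k ∧ Set.range k = r ⁻¹' Set.range i₁ ∩ s ⁻¹' Set.range i₂ := by
  -- Up to the identifications with the chosen pullbacks, `k` is the map induced by the three open
  -- immersions.
  have hk : k = h.isoPullback.hom ≫ pullback.map a' b' a b i₁ i₂ i₃ e₁ e₂ ≫ hP.isoPullback.inv := by
    refine hP.hom_ext ?_ ?_
    · have m : pullback.map a' b' a b i₁ i₂ i₃ e₁ e₂ ≫ pullback.fst a b =
        pullback.fst a' b' ≫ i₁ := pullback.lift_fst _ _ _
      rw [hk₁, Category.assoc, Category.assoc, hP.isoPullback_inv_fst, m,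
        h.isoPullback_hom_fst_assoc]
    · have m : pullback.map a' b' a b i₁ i₂ i₃ e₁ e₂ ≫ pullback.snd a b =
        pullback.snd a' b' ≫ i₂ := pullback.lift_snd _ _ _
      rw [hk₂, Category.assoc, Category.assoc, hP.isoPullback_inv_snd, m,
        h.isoPullback_hom_snd_assoc]
  refine ⟨hk ▸ inferInstance, ?_⟩
  have hk' : h.isoPullback.inv ≫ k ≫ hP.isoPullback.hom = pullback.map a' b' a b i₁ i₂ i₃ e₁ e₂ := by
    simp [hk]
  have hr := Scheme.Pullback.range_map a' b' a b i₁ i₂ i₃ e₁ e₂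
  rw [← hk'] at hr
  ext x
  have h₁ : pullback.fst a b (hP.isoPullback.hom x) = r x := by
    rw [← Scheme.Hom.comp_apply, hP.isoPullback_hom_fst]
  have h₂ : pullback.snd a b (hP.isoPullback.hom x) = s x := by
    rw [← Scheme.Hom.comp_apply, hP.isoPullback_hom_snd]
  have hx := Set.ext_iff.1 hr (hP.isoPullback.hom x)
  rw [Set.mem_inter_iff, Set.mem_preimage, Set.mem_preimage, h₁, h₂] at hx
  rw [Set.mem_inter_iff, Set.mem_preimage, Set.mem_preimage, ← hx]
  constructor
  · rintro ⟨y, rfl⟩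
    exact ⟨h.isoPullback.hom y, by
      rw [← Scheme.Hom.comp_apply, ← Scheme.Hom.comp_apply, Iso.hom_inv_id_assoc]⟩
  · rintro ⟨y, hy⟩
    refine ⟨h.isoPullback.inv y, hP.isoPullback.hom.isOpenEmbedding.injective ?_⟩
    rw [← hy]
    simp only [Scheme.Hom.comp_apply]

theorem isOpenImmersion_ι_comp {p : F.Hom G} (hsurj : Function.Surjective p.toLinearMap)
    (hp : p.IsWeaklySemistable) (q : H.Hom G) {P : Scheme.{u}} {r : P ⟶ F.realization}
    {s : P ⟶ H.realization} (hP : IsPullback r s p.realization q.realization)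
    {f : (Fan.fiberProduct p q).realization ⟶ P}
    (f₁ : f ≫ r = (Fan.fiberProductFst p q).realization)
    (f₂ : f ≫ s = (Fan.fiberProductSnd p q).realization) (σ : F.cones) (τ : H.cones)
    (hτ : ∀ z ∈ τ.1, realMap q.toLinearMap z ∈ σ.1.map (realMap p.toLinearMap))
    (C : (Fan.fiberProduct p q).cones)
    (hC : C.1 = fiberCone p.toLinearMap q.toLinearMap σ.1 τ.1) :
    IsOpenImmersion ((Fan.fiberProduct p q).ι C ≫ f) ∧
      Set.range ((Fan.fiberProduct p q).ι C ≫ f) =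
        r ⁻¹' Set.range (F.ι σ) ∩ s ⁻¹' Set.range (H.ι τ) := by
  obtain ⟨C, hC'⟩ := C
  obtain rfl : C = _ := hC
  let κ : G.cones := ⟨_, hp.map_cone_mem _ σ.2⟩
  have hκ : ∀ x ∈ σ.1, realMap p.toLinearMap x ∈ κ.1 := fun x hx =>
    PointedCone.mem_map.2 ⟨x, hx, rfl⟩
  have hC₁ : ∀ x ∈ fiberCone p.toLinearMap q.toLinearMap σ.1 τ.1,
    realMap (fiberFst _ _) x ∈ σ.1 := fun x hx => (mem_fiberCone.1 hx).1
  have hC₂ : ∀ x ∈ fiberCone p.toLinearMap q.toLinearMap σ.1 τ.1,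
    realMap (fiberSnd _ _) x ∈ τ.1 := fun x hx => (mem_fiberCone.1 hx).2
  have e₁ := (Fan.fiberProductFst p q).ι_realization ⟨_, hC'⟩ σ hC₁
  have e₂ := (Fan.fiberProductSnd p q).ι_realization ⟨_, hC'⟩ τ hC₂
  rw [← f₁, ← Category.assoc] at e₁
  rw [← f₂, ← Category.assoc] at e₂
  exact isOpenImmersion_of_isPullback (p.ι_realization σ κ hκ).symm
    (q.ι_realization τ κ hτ).symm
    (isPullback_chartMap hp hsurj σ.2 rfl hκ hτ hC₁ hC₂) hP e₁ e₂

theorem isPullback_realization (p : F.Hom G) (hsurj : Function.Surjective p.toLinearMap)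
    (hp : p.IsWeaklySemistable) (q : H.Hom G) :
    IsPullback (Fan.fiberProductFst p q).realization (Fan.fiberProductSnd p q).realization
      p.realization q.realization := by
  obtain ⟨P, r, s, hP⟩ : ∃ (P : Scheme.{u}) (r : P ⟶ F.realization) (s : P ⟶ H.realization),
      IsPullback r s p.realization q.realization := ⟨_, _, _, .of_hasPullback _ _⟩
  obtain ⟨f, f₁, f₂⟩ : ∃ f : (Fan.fiberProduct p q).realization ⟶ P,
      f ≫ r = (Fan.fiberProductFst p q).realization ∧
      f ≫ s = (Fan.fiberProductSnd p q).realization :=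
    ⟨_, hP.lift_fst _ _ (fiberProduct_realization_comm p q), hP.lift_snd _ _ _⟩
  suffices IsIso f from
    hP.of_iso' (asIso f) (Iso.refl _) (Iso.refl _) (Iso.refl _)
      (by simp [f₁]) (by simp [f₂]) (by simp) (by simp)
  -- Only pairs with `q(τ) ⊆ p(σ)` are used: for them `p(σ)` serves as `κ` and `isPullback_chartMap`
  -- applies.
  let J := {P : F.cones × H.cones //
    ∀ z ∈ P.2.1, realMap q.toLinearMap z ∈ P.1.1.map (realMap p.toLinearMap)}
  let C : J → (Fan.fiberProduct p q).cones := fun j =>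
    ⟨fiberCone p.toLinearMap q.toLinearMap j.1.1.1 j.1.2.1, _, j.1.1.2, _, j.1.2.2, _,
      hp.map_cone_mem _ j.1.1.2, fun x hx => PointedCone.mem_map.2 ⟨x, hx, rfl⟩, j.2, rfl⟩
  have hopen := fun j : J =>
    isOpenImmersion_ι_comp hsurj hp q hP f₁ f₂ j.1.1 j.1.2 j.2 (C j) rfl
  refine isIso_of_isOpenImmersion_comp f (fun j => (Fan.fiberProduct p q).ι (C j))
    (fun j => (hopen j).1) (fun y => ?_) fun j x hx => ?_
  · obtain ⟨σ, hσ, hσmin⟩ := F.exists_least_cone (r y)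
    obtain ⟨τ, hτ, hτmin⟩ := H.exists_least_cone (s y)
    have e : p.realization (r y) = q.realization (s y) := by
      rw [← Scheme.Hom.comp_apply, ← Scheme.Hom.comp_apply, hP.w]
    let ρ : G.cones := ⟨_, hp.map_cone_mem _ σ.2⟩
    have hρ : p.realization (r y) ∈ Set.range (G.ι ρ) :=
      p.realization_mem_range_ι (fun y hy => PointedCone.mem_map.2 ⟨y, hy, rfl⟩) hσ
    -- The common image of `r y` and `s y` lies in the chart of `p(σ)`, so the least cone `τ` of `s
    -- y` is taken into `p(σ)`.
    let j : J := ⟨(σ, τ), q.map_mem_of_realization_mem hτ hτmin (κ := ρ) (e ▸ hρ)⟩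
    refine ⟨j, ?_⟩
    rw [(hopen j).2]
    exact ⟨hσ, hτ⟩
  · rw [(hopen j).2] at hx
    refine mem_range_ι_fiberCone p q (σ := j.1.1) (τ := j.1.2) rfl ?_ ?_
    · rw [← f₁, Scheme.Hom.comp_apply]
      exact hx.1
    · rw [← f₂, Scheme.Hom.comp_apply]
      exact hx.2

end Cartesian

end Toric

theorem mainTheorem5 {N Q Q' : Type u}
    [AddCommGroup N] [Module.Free ℤ N] [Module.Finite ℤ N]
    [AddCommGroup Q] [Module.Free ℤ Q] [Module.Finite ℤ Q]
    [AddCommGroup Q'] [Module.Free ℤ Q'] [Module.Finite ℤ Q']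
    (F : Toric.Fan N) (G : Toric.Fan Q) (G' : Toric.Fan Q')
    (p : F.Hom G) (hsurj : Function.Surjective p.toLinearMap) (hp : p.IsWeaklySemistable)
    (q : G'.Hom G) :
    CategoryTheory.IsPullback
      (Toric.Fan.fiberProductFst p q).realization (Toric.Fan.fiberProductSnd p q).realization
      p.realization q.realization ∧
    (Toric.Fan.fiberProductSnd p q).IsWeaklySemistable ∧
    Function.Surjective (Toric.Fan.fiberProductSnd p q).toLinearMap := by
  refine ⟨Toric.isPullback_realization p hsurj hp q, hp.fiberProductSnd q, fun l => ?_⟩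
  obtain ⟨n, hn⟩ := hsurj (q.toLinearMap l)
  exact ⟨⟨(n, l), hn⟩, rfl⟩
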